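/- **Setting.** Let $\mathcal P$ be the set of all partitions, $\lambda'$ the conjugate, $l(\lambda)$ the length and $|\lambda|$ the size of $\lambda\in\mathcal P$. Let $\mathcal P^{+}$ be the set of partitions all of whose parts $\lambda_i$ are even, and $\mathcal P^{-}$ the set of partitions all of whose conjugate parts $\lambda'_i$ are even. Let $X=(x_i)$ and $Y=(y_j)$ be finite or infinite families of indeterminates (or, more generally, of elements of a Hausdorff topological commutative ring $R$ in which $2$ is invertible, such that $\prod_i(1-x_it)$ and $\prod_j(1-y_jt)$ converge coefficientwise in $R[[t]]$). Define $h_m(X|Y)$ by $$\sum_{m\ge 0}h_m(X|Y)\,t^m=\frac{\prod_j(1-y_jt)}{\prod_i(1-x_it)},\qquad h_m(X|Y)=0\quad(m<0),$$ and, for non-empty $\lambda\in\mathcal P$ and $1\le i,j\le l(\lambda)$, writing $h_m=h_m(X|Y)$, $$S_\lambda(X|Y)=\det\bigl(h_{\lambda_i-i+j}\bigr),\qquad S_{[\lambda]}(X|Y)=\det\bigl(h_{\lambda_i-i+j}-h_{\lambda_i-i-j}\bigr),$$ $$S_{\langle\lambda\rangle}(X|Y)=\tfrac12\det\bigl(h_{\lambda_i-i+j}+h_{\lambda_i-i-j+2}\bigr),$$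 with $S_\emptyset=S_{[\emptyset]}=S_{\langle\emptyset\rangle}=1$. Let $\mathrm{LR}^{\lambda}_{\nu,\mu}$ be the Littlewood–Richardson coefficients, that is, the structure constants in $S_\mu(T)S_\nu(T)=\sum_{\lambda}\mathrm{LR}^{\lambda}_{\nu,\mu}S_\lambda(T)$ for ordinary Schur functions $S_\lambda(T)=S_\lambda(T|\emptyset)$. **Proposition.** Let $\xi\in\{1,-1\}$ and $\lambda\in\mathcal P$. Only finitely many pairs $(\nu,\mu)\in\mathcal P\times\mathcal P$ satisfy $\mathrm{LR}^{\lambda}_{\nu,\mu}\neq0$, so that the following sums are finite, and $$S_\lambda(X|Y)=\sum_{\mu\in\mathcal P}\sum_{\kappa\in\mathcal P^{+}}\mathrm{LR}^{\lambda}_{\kappa,\mu}\,S_{[\mu]}(X|Y)=\sum_{\mu\in\mathcal P}\sum_{\kappa\in\mathcal P^{-}}\mathrm{LR}^{\lambda}_{\kappa,\mu}\,S_{\langle\mu\rangle}(X|Y),$$ $$S_\lambda(X|Y\sqcup\{\xi\})=\sum_{\mu\in\mathcal P}\sum_{\kappa\in\mathcal P^{-}}\mathrm{LR}^{\lambda}_{\kappa,\mu}\,S_{[\mu]}(X\sqcup\{-\xi\}|Y)=\sum_{\mu,\nu\in\mathcal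 P}(-\xi)^{|\nu|}\,\mathrm{LR}^{\lambda}_{\nu,\mu}\,S_{[\mu]}(X|Y),$$ $$S_\lambda(X\sqcup\{\xi\}|Y)=\sum_{\mu\in\mathcal P}\sum_{\kappa\in\mathcal P^{+}}\mathrm{LR}^{\lambda}_{\kappa,\mu}\,S_{\langle\mu\rangle}(X|Y\sqcup\{-\xi\})=\sum_{\mu,\nu\in\mathcal P}\xi^{|\nu|}\,\mathrm{LR}^{\lambda}_{\nu,\mu}\,S_{\langle\mu\rangle}(X|Y),$$ $$S_\lambda(X|Y\sqcup\{1,-1\})=\sum_{\mu\in\mathcal P}\sum_{\kappa\in\mathcal P^{-}}\mathrm{LR}^{\lambda}_{\kappa,\mu}\,S_{[\mu]}(X|Y),$$ $$S_\lambda(X\sqcup\{1,-1\}|Y)=\sum_{\mu\in\mathcal P}\sum_{\kappa\in\mathcal P^{+}}\mathrm{LR}^{\lambda}_{\kappa,\mu}\,S_{\langle\mu\rangle}(X|Y).$$ -/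

import Mathlib

open scoped PowerSeries PowerSeries.WithPiTopology MvPowerSeries.WithPiTopology

noncomputable section

namespace SuperSchur

/-! ### Partitions

Partitions are Young diagrams: `lam.rowLen i` is the part with (zero-based) index `i`, the column
lengths `lam.colLen j` are the parts of the conjugate partition, `lam.colLen 0` is the length and
`lam.card` the size. -/

/-- Partitions all of whose parts are even. -/
def evenRows : Set YoungDiagram := {lam | ∀ i, Even (lam.rowLen i)}

/-- Partitions all of whose conjugate parts are even. -/
def evenCols : Set YoungDiagram := {lam | ∀ j, Even (lam.colLen j)}

/-! ### Jacobi-Trudi determinants of a sequence `(h m)`, `m ∈ ℤ`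

The row and column indices of the matrices start at `0`. -/

section Determinants

variable {R : Type*} [CommRing R]

/-- `det (h_{λ_i - i + j})`, of size the length of `λ`. -/
def jacobiTrudi (h : ℤ → R) (lam : YoungDiagram) : R :=
  Matrix.det (Matrix.of fun i j : Fin (lam.colLen 0) =>
    h ((lam.rowLen i : ℤ) - (i : ℤ) + (j : ℤ)))

/-- `det (h_{λ_i - i + j} - h_{λ_i - i - j})`, where `i`, `j` are counted from `1`. -/
def jacobiTrudiOrth (h : ℤ → R) (lam : YoungDiagram) : R :=
  Matrix.det (Matrix.of fun i j : Fin (lam.colLen 0) =>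
    h ((lam.rowLen i : ℤ) - (i : ℤ) + (j : ℤ)) - h ((lam.rowLen i : ℤ) - (i : ℤ) - (j : ℤ) - 2))

open scoped Classical in
/-- `(1/2) det (h_{λ_i - i + j} + h_{λ_i - i - j + 2})`, where `i`, `j` are counted from `1`,
for a non-empty partition, and `1` for the empty one. -/
def jacobiTrudiSymp [Invertible (2 : R)] (h : ℤ → R) (lam : YoungDiagram) : R :=
  if lam = ⊥ then 1
  else ⅟(2 : R) * Matrix.det (Matrix.of fun i j : Fin (lam.colLen 0) =>
    h ((lam.rowLen i : ℤ) - (i : ℤ) + (j : ℤ)) + h ((lam.rowLen i : ℤ) - (i : ℤ) - (j : ℤ)))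

end Determinants

/-! ### Littlewood-Richardson coefficients -/

/-- The Schur polynomial `S_λ(t_1, …, t_n)`. -/
def schurPoly (n : ℕ) (lam : YoungDiagram) : MvPolynomial (Fin n) ℤ :=
  jacobiTrudi (fun m : ℤ => if 0 ≤ m then MvPolynomial.hsymm (Fin n) ℤ m.toNat else 0) lam

/-- `c` is the expansion of `S_μ(T) S_ν(T)` in the Schur functions `S_λ(T)`, in any number of
variables `T`. -/
def IsSchurExpansion (μ ν : YoungDiagram) (c : YoungDiagram →₀ ℤ) : Prop :=
  ∀ n : ℕ, schurPoly n μ * schurPoly n ν = c.sum fun lam a => a • schurPoly n lam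

open scoped Classical in
/-- The Littlewood-Richardson coefficient `LR^λ_{μ,ν}`: the coefficient of `S_λ` in the
(existing and unique) expansion of `S_μ S_ν` in Schur functions. -/
def littlewoodRichardson (lam μ ν : YoungDiagram) : ℤ :=
  if hc : ∃ c, IsSchurExpansion μ ν c then hc.choose lam else 0

/-! ### Supersymmetric functions of two alphabets

An alphabet is a family `x` of elements of a Hausdorff topological commutative ring `R`, for which
the product `∏ (1 - x_i t)` converges in `R⟦t⟧` (coefficientwise convergence). This is automatic
for finite families, and for (possibly infinite) families of indeterminates it is shown below. -/

section Alphabets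

variable {R : Type*} [CommRing R] {ι κ : Type*}

/-- The factor `1 - a t` of `R⟦t⟧`. -/
def oneSub (a : R) : R⟦X⟧ := 1 - PowerSeries.C a * PowerSeries.X

/-- The product `∏ (1 - x_i t)` converges. -/
def IsAlphabet [TopologicalSpace R] (x : ι → R) : Prop :=
  Multipliable fun i => oneSub (x i)

/-- The generating function `∏ (1 - y_j t) / ∏ (1 - x_i t)`; the denominator has constant
coefficient `1`. -/
def genFun [TopologicalSpace R] (x : ι → R) (y : κ → R) : R⟦X⟧ :=
  (∏' j, oneSub (y j)) * PowerSeries.invOfUnit (∏' i, oneSub (x i)) 1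

/-- The complete supersymmetric function `h_m(X|Y)`, which is `0` for `m < 0`. -/
def complete [TopologicalSpace R] (x : ι → R) (y : κ → R) (m : ℤ) : R :=
  if 0 ≤ m then PowerSeries.coeff m.toNat (genFun x y) else 0

/-- The supersymmetric Schur function `S_λ(X|Y)`. -/
def schur [TopologicalSpace R] (lam : YoungDiagram) (x : ι → R) (y : κ → R) : R :=
  jacobiTrudi (complete x y) lam

/-- The function `S_[λ](X|Y)`. -/
def orthSchur [TopologicalSpace R] (lam : YoungDiagram) (x : ι → R) (y : κ → R) : R :=
  jacobiTrudiOrth (complete x y) lam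

/-- The function `S_⟨λ⟩(X|Y)`. -/
def sympSchur [TopologicalSpace R] [Invertible (2 : R)] (lam : YoungDiagram)
    (x : ι → R) (y : κ → R) : R :=
  jacobiTrudiSymp (complete x y) lam

/-- The alphabet `X ⊔ {a}`. -/
def adjoin (x : ι → R) (a : R) : ι ⊕ Unit → R := Sum.elim x fun _ => a

end Alphabets

/-- A family of distinct indeterminates, finite or not, is an alphabet. -/
theorem isAlphabet_indeterminates {K σ ι : Type*} [CommRing K] [TopologicalSpace K]
    (s : ι → σ) (hs : Function.Injective s) :
    IsAlphabet fun i => (MvPowerSeries.X (s i) : MvPowerSeries σ K) := by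
  classical
  let f : ι → (MvPowerSeries σ K)⟦X⟧ := fun i => oneSub (MvPowerSeries.X (s i))
  let F : (σ →₀ ℕ) → Finset ι := fun m => m.support.preimage s hs.injOn
  have step : ∀ (m : σ →₀ ℕ) (k : ℕ) (a : ι) (P : (MvPowerSeries σ K)⟦X⟧), a ∉ F m →
      MvPowerSeries.coeff m (PowerSeries.coeff k (f a * P)) =
        MvPowerSeries.coeff m (PowerSeries.coeff k P) := by
    intro m k a P ha
    have h0 : m (s a) = 0 := by simpa [F] using ha
    have hz : ∀ Q : MvPowerSeries σ K,
        MvPowerSeries.coeff m (MvPowerSeries.X (s a) * Q) = 0 := by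
      intro Q
      rw [MvPowerSeries.X, MvPowerSeries.coeff_monomial_mul, if_neg]
      intro hle
      have := hle (s a)
      simp [h0] at this
    cases k with
    | zero => simp [f, oneSub, sub_mul, mul_assoc]
    | succ k =>
      simp only [f, oneSub, sub_mul, one_mul, map_sub, mul_assoc, PowerSeries.coeff_C_mul,
        PowerSeries.coeff_succ_X_mul, hz, sub_zero]
  have stable : ∀ (m : σ →₀ ℕ) (k : ℕ) (G : Finset ι), F m ⊆ G →
      MvPowerSeries.coeff m (PowerSeries.coeff k (∏ i ∈ G, f i)) =
        MvPowerSeries.coeff m (PowerSeries.coeff k (∏ i ∈ F m, f i)) := by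
    intro m k G hG
    obtain ⟨D, hD, rfl⟩ : ∃ D, Disjoint D (F m) ∧ D ∪ F m = G :=
      ⟨G \ F m, Finset.sdiff_disjoint, Finset.sdiff_union_of_subset hG⟩
    clear hG
    rw [Finset.prod_union hD]
    induction D using Finset.induction_on with
    | empty => simp
    | insert a D ha ih =>
      rw [Finset.disjoint_insert_left] at hD
      rw [Finset.prod_insert ha, mul_assoc, step m k a _ hD.1, ih hD.2]
  let L : ℕ → MvPowerSeries σ K := fun k m =>
    MvPowerSeries.coeff m (PowerSeries.coeff k (∏ i ∈ F m, f i))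
  refine ⟨PowerSeries.mk L, ?_⟩
  rw [HasProd, PowerSeries.WithPiTopology.tendsto_iff_coeff_tendsto]
  intro k
  rw [MvPowerSeries.WithPiTopology.tendsto_iff_coeff_tendsto]
  intro m
  refine tendsto_const_nhds.congr' ?_
  simp only [SummationFilter.unconditional_filter]
  filter_upwards [Filter.eventually_ge_atTop (F m)] with G hG
  rw [PowerSeries.coeff_mk]
  exact (stable m k G hG).symm

end SuperSchur

end

open SuperSchur

/-!
The identities are compared with power series in finitely many auxiliary variables
`T = (t_1, …, t_n)`, with `n` large. Write `V` for the Vandermonde product, `δ = (n - 1, …, 1, 0)`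
and `a_{λ+δ} = V s_λ(T)` for the alternants. A power series which is alternating in `T` is
determined by its coefficients at the exponents `λ + δ` (`IsAlternating.coeffAt_eq`), and the
coefficient of `T^m` in `det (G_j(t_k))` is `det ([t^{m_k}] G_j)` (`coeffAt_det_inVar`). Hence, for
a series `H` with coefficients `h_m` and `h_0 = 1`, the coefficients at `λ + δ` of

* `V ∏ H(t_k) = det (t_k^{n-j} H(t_k))` are the determinants `S_λ`,
* `V ∏_{i≤j} (1 - t_i t_j) ∏ H(t_k) = det ((t_k^{n-j} - t_k^{n+j}) H(t_k))` are the `S_[λ]`,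
* `V ∏_{i<j} (1 - t_i t_j) ∏ H(t_k) = ½ det ((t_k^{n-j} + t_k^{n+j-2}) H(t_k))` are the `S_⟨λ⟩`.

The products on the left come from the Weyl denominator formulas of types `C` and `D`
(`det_pow_sub_pow`, `det_pow_add_pow`).

On the other side stand the Littlewood identities: the sum of the `s_κ(T)` over the partitions with
even parts is `∏_{i≤j} (1 - t_i t_j)⁻¹`, the one over the partitions with even conjugate parts is
`∏_{i<j} (1 - t_i t_j)⁻¹`, and the sum of `ξ^|κ| s_κ(T)` over all partitions is
`∏ (1 - ξ t_k)⁻¹ ∏_{i<j} (1 - t_i t_j)⁻¹`. All three have the form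
`F = ∏ φ(t_k)⁻¹ ∏_{i<j} (1 - t_i t_j)⁻¹`. In each case the values
`φ(t_k) ∏_{i≠k} (1 - t_i t_k)` are interpolated by a polynomial of degree less than `n` with an
explicit constant term `1 - w`; expanding the Vandermonde determinant whose last column is replaced
by these values gives
`(1 - w) V F = ∑_k ± (∏_{i≠k} t_i) (V F)(t_1, …, t̂_k, …, t_n)` (`littlewood_recursion`), from which
the coefficients of `V F` at the exponents `κ + δ` follow by induction (`coeffAt_addStair_eq`).

Each identity to be proved compares `V ∏ H(t_k)` with the product of some `V F` and the cofactor
of `V` in one of the products above, for a series `K` in place of `H`. As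
`s_κ s_μ V = ∑ LR^λ_{κμ} a_{λ+δ}`, the coefficient at `λ + δ` of such a product is the required
combination of the `S_[μ]` or `S_⟨μ⟩` (`coeffAt_mul_eq_sum_littlewoodRichardson`), and what is left
is a relation between `H`, `K` and `φ` in one variable (`jacobiTrudi_eq_finsum_orth`,
`jacobiTrudi_eq_finsum_symp`). That the Littlewood-Richardson coefficients are these structure
constants in any large number of variables is `littlewoodRichardson_eq_structureCoeff`; it rests on
the bialternant formula `alternant_eq_vdm_mul` and on setting superfluous variables to `0`.
-/

namespace SuperSchur

/-! ### Young diagrams with at most `n` rows -/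

theorem rowLen_eq_zero_of_colLen_le {lam : YoungDiagram} {i : ℕ} (h : lam.colLen 0 ≤ i) :
    lam.rowLen i = 0 := by
  by_contra hne
  have : (i, 0) ∈ lam := YoungDiagram.mem_iff_lt_rowLen.2 (Nat.pos_of_ne_zero hne)
  exact absurd (YoungDiagram.mem_iff_lt_colLen.1 this) (not_lt.2 h)

theorem ext_rowLen {lam mu : YoungDiagram} (h : ∀ i, lam.rowLen i = mu.rowLen i) : lam = mu := by
  apply YoungDiagram.ext
  ext ⟨i, j⟩
  simp only [YoungDiagram.mem_cells, YoungDiagram.mem_iff_lt_rowLen, h]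

theorem ext_rowLen_fin {n : ℕ} {lam mu : YoungDiagram} (hl : lam.colLen 0 ≤ n)
    (hm : mu.colLen 0 ≤ n) (h : ∀ i : Fin n, lam.rowLen i = mu.rowLen i) : lam = mu := by
  refine ext_rowLen fun i => ?_
  rcases lt_or_ge i n with hi | hi
  · exact h ⟨i, hi⟩
  · rw [rowLen_eq_zero_of_colLen_le (hl.trans hi), rowLen_eq_zero_of_colLen_le (hm.trans hi)]

theorem card_eq_sum_rowLen {n : ℕ} {lam : YoungDiagram} (hl : lam.colLen 0 ≤ n) :
    lam.card = ∑ i : Fin n, lam.rowLen i := by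
  have hmaps : ∀ c ∈ lam.cells, c.1 ∈ Finset.range n := by
    rintro ⟨i, j⟩ hc
    rw [YoungDiagram.mem_cells] at hc
    have : (i, 0) ∈ lam := lam.up_left_mem le_rfl (Nat.zero_le _) hc
    exact Finset.mem_range.2 ((YoungDiagram.mem_iff_lt_colLen.1 this).trans_le hl)
  rw [Fin.sum_univ_eq_sum_range (fun i => lam.rowLen i)]
  rw [YoungDiagram.card, Finset.card_eq_sum_card_fiberwise hmaps]
  refine Finset.sum_congr rfl fun i _ => ?_
  rw [YoungDiagram.rowLen_eq_card]
  rfl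

theorem colLen_zero_le_card (lam : YoungDiagram) : lam.colLen 0 ≤ lam.card := by
  rw [YoungDiagram.colLen_eq_card]
  exact Finset.card_le_card (Finset.filter_subset _ _)

theorem rowLen_zero_le_card (lam : YoungDiagram) : lam.rowLen 0 ≤ lam.card := by
  rw [YoungDiagram.rowLen_eq_card]
  exact Finset.card_le_card (Finset.filter_subset _ _)

theorem finite_card_le (N : ℕ) : {lam : YoungDiagram | lam.card ≤ N}.Finite := by
  refine Set.Finite.of_finite_image (f := YoungDiagram.cells) ?_ ?_
  · refine (Finset.range N ×ˢ Finset.range N).powerset.finite_toSet.subset ?_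
    rintro _ ⟨lam, hlam, rfl⟩
    rw [Finset.mem_coe, Finset.mem_powerset]
    rintro ⟨i, j⟩ hc
    rw [YoungDiagram.mem_cells] at hc
    have h1 := YoungDiagram.mem_iff_lt_colLen.1 (lam.up_left_mem le_rfl (Nat.zero_le j) hc)
    have h2 := YoungDiagram.mem_iff_lt_rowLen.1 (lam.up_left_mem (Nat.zero_le i) le_rfl hc)
    have h3 := colLen_zero_le_card lam
    have h4 := rowLen_zero_le_card lam
    simp only [Set.mem_ofPred_eq] at hlam
    simp only [Finset.mem_product, Finset.mem_range]
    omega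
  · intro a _ b _ h
    exact YoungDiagram.ext h

/-- The finite set of partitions of size at most `N`. -/
noncomputable def partsLE (N : ℕ) : Finset YoungDiagram := (finite_card_le N).toFinset

theorem mem_partsLE {N : ℕ} {lam : YoungDiagram} : lam ∈ partsLE N ↔ lam.card ≤ N := by
  simp [partsLE]

theorem exists_rowLen_eq {n : ℕ} (f : Fin n → ℕ) (hf : Antitone f) :
    ∃ lam : YoungDiagram, lam.colLen 0 ≤ n ∧ ∀ i : Fin n, lam.rowLen i = f i := by
  have hw : (List.ofFn f).SortedGE := by
    rw [List.sortedGE_ofFn_iff]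
    exact hf
  refine ⟨YoungDiagram.ofRowLens (List.ofFn f) hw, ?_, fun i => ?_⟩
  · by_contra hlt
    have := YoungDiagram.mem_iff_lt_colLen.2 (not_le.1 hlt)
    rw [YoungDiagram.mem_ofRowLens] at this
    obtain ⟨h, -⟩ := this
    simp at h
  · have := YoungDiagram.rowLen_ofRowLens (hw := hw) ⟨i, by simp⟩
    simpa using this

/-- The exponent vector `λ + δ`, with `δ = (n - 1, …, 1, 0)`. -/
def shifted (n : ℕ) (lam : YoungDiagram) (k : Fin n) : ℕ := lam.rowLen k + (k.rev : ℕ)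

theorem shifted_strictAnti (n : ℕ) (lam : YoungDiagram) : StrictAnti (shifted n lam) := by
  intro i j hij
  have h1 := lam.rowLen_anti i j (by exact_mod_cast hij.le)
  have h2 : (j.rev : ℕ) < i.rev := Fin.rev_lt_rev.2 hij
  unfold shifted
  omega

theorem shifted_injective {n : ℕ} {lam mu : YoungDiagram} (hl : lam.colLen 0 ≤ n)
    (hm : mu.colLen 0 ≤ n) (h : shifted n lam = shifted n mu) : lam = mu :=
  ext_rowLen_fin hl hm fun i => by
    have := congrFun h i
    unfold shifted at this
    omega

theorem sum_shifted {n : ℕ} {lam : YoungDiagram} (hl : lam.colLen 0 ≤ n) :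
    ∑ k, shifted n lam k = lam.card + ∑ k : Fin n, (k.rev : ℕ) := by
  simp only [shifted, Finset.sum_add_distrib, card_eq_sum_rowLen hl]

/-- A strictly decreasing vector of natural numbers is `λ + δ` for a partition `λ`. -/
theorem exists_shifted_eq {n : ℕ} (m : Fin n → ℕ) (hm : StrictAnti m) :
    ∃ lam : YoungDiagram, lam.colLen 0 ≤ n ∧ shifted n lam = m := by
  have hge : ∀ i j : Fin n, i ≤ j → m j + (j - i : ℕ) ≤ m i := by
    intro i j hij
    obtain ⟨i, hi⟩ := i
    obtain ⟨j, hj⟩ := j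
    simp only [Fin.mk_le_mk] at hij
    induction j, hij using Nat.le_induction with
    | base => simp
    | succ j hij ih =>
      have h1 := ih (by omega)
      have h2 : m ⟨j + 1, hj⟩ < m ⟨j, by omega⟩ := hm (by simp)
      simp only at h1 ⊢
      omega
  have hrev : ∀ i : Fin n, (i.rev : ℕ) ≤ m i := by
    intro i
    have hn : n - 1 < n := by have := i.2; omega
    have h1 := hge i ⟨n - 1, hn⟩ (by rw [Fin.le_def]; simp only; have := i.2; omega)
    simp only [Fin.val_rev] at h1 ⊢
    omega
  obtain ⟨lam, hl, hrow⟩ := exists_rowLen_eq (fun i => m i - (i.rev : ℕ)) (by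
    intro i j hij
    have h1 := hge i j hij
    have h2 := hrev j
    have : (i : ℕ) ≤ j := hij
    simp only [Fin.val_rev] at h1 h2 ⊢
    have := j.2
    omega)
  refine ⟨lam, hl, funext fun i => ?_⟩
  have := hrev i
  rw [shifted, hrow]
  omega

theorem exists_perm_strictAnti {n : ℕ} (m : Fin n → ℕ) (hm : Function.Injective m) :
    ∃ σ : Equiv.Perm (Fin n), StrictAnti (m ∘ σ) := by
  refine ⟨Fin.revPerm.trans (Tuple.sort m), ?_⟩
  have h := (Tuple.monotone_sort m).strictMono_of_injective
    (hm.comp (Tuple.sort m).injective)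
  intro i j hij
  exact h (Fin.rev_lt_rev.2 hij)

/-! ### Alternating power series -/

section Alternating

variable {R : Type*} [CommRing R] {n : ℕ}

/-- The coefficient of `T^m`, for an exponent vector `m` given as a function. -/
noncomputable def coeffAt (m : Fin n → ℕ) : MvPowerSeries (Fin n) R →ₗ[R] R :=
  MvPowerSeries.coeff (Finsupp.equivFunOnFinite.symm m)

theorem coeff_eq_coeffAt (m : Fin n →₀ ℕ) (f : MvPowerSeries (Fin n) R) :
    MvPowerSeries.coeff m f = coeffAt (m : Fin n → ℕ) f := by
  rw [coeffAt, Finsupp.equivFunOnFinite_symm_coe]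

/-- A power series in `n` variables is alternating if permuting the variables multiplies it by the
sign, and the coefficients at exponents with a repetition vanish (the latter follows from the
former when `2` is not a zero divisor). -/
def IsAlternating (f : MvPowerSeries (Fin n) R) : Prop :=
  (∀ (m : Fin n → ℕ) (σ : Equiv.Perm (Fin n)),
    coeffAt (m ∘ σ) f = ((Equiv.Perm.sign σ : ℤ) : R) * coeffAt m f) ∧
  ∀ m : Fin n → ℕ, ¬ Function.Injective m → coeffAt m f = 0

/-- Two alternating series agree up to degree `N + |δ|` if they have the same coefficients at the
exponents `λ + δ` with `|λ| ≤ N`. -/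
theorem IsAlternating.coeffAt_eq {f g : MvPowerSeries (Fin n) R} (hf : IsAlternating f)
    (hg : IsAlternating g) {N : ℕ}
    (h : ∀ lam : YoungDiagram, lam.colLen 0 ≤ n → lam.card ≤ N →
      coeffAt (shifted n lam) f = coeffAt (shifted n lam) g)
    (m : Fin n → ℕ) (hm : ∑ k, m k ≤ N + ∑ k : Fin n, (k.rev : ℕ)) :
    coeffAt m f = coeffAt m g := by
  by_cases hinj : Function.Injective m
  · obtain ⟨σ, hσ⟩ := exists_perm_strictAnti m hinj
    obtain ⟨lam, hl, hlam⟩ := exists_shifted_eq _ hσ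
    have hcard : lam.card ≤ N := by
      have h1 := sum_shifted hl
      rw [hlam] at h1
      have h2 : ∑ k, (m ∘ σ) k = ∑ k, m k := Equiv.sum_comp σ m
      omega
    have key := h lam hl hcard
    rw [hlam, hf.1, hg.1] at key
    have hu : IsUnit ((Equiv.Perm.sign σ : ℤ) : R) :=
      (Units.isUnit (Equiv.Perm.sign σ)).map (Int.castRingHom R)
    exact hu.mul_left_cancel key
  · rw [hf.2 m hinj, hg.2 m hinj]

theorem IsAlternating.add {f g : MvPowerSeries (Fin n) R} (hf : IsAlternating f)
    (hg : IsAlternating g) : IsAlternating (f + g) :=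
  ⟨fun m σ => by simp only [map_add, hf.1, hg.1, mul_add],
    fun m hm => by simp only [map_add, hf.2 m hm, hg.2 m hm, add_zero]⟩

theorem IsAlternating.smul {f : MvPowerSeries (Fin n) R} (a : R) (hf : IsAlternating f) :
    IsAlternating (a • f) :=
  ⟨fun m σ => by simp only [map_smul, hf.1, smul_eq_mul, mul_left_comm],
    fun m hm => by simp only [map_smul, hf.2 m hm, smul_zero]⟩

theorem isAlternating_sum {ι : Type*} (s : Finset ι) (f : ι → MvPowerSeries (Fin n) R)
    (hf : ∀ i ∈ s, IsAlternating (f i)) : IsAlternating (∑ i ∈ s, f i) :=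
  Finset.sum_induction f IsAlternating (fun _ _ => IsAlternating.add)
    ⟨fun _ _ => by simp, fun _ _ => by simp⟩ hf

theorem coeffAt_rename_perm (f : MvPowerSeries (Fin n) R) (σ : Equiv.Perm (Fin n))
    (m : Fin n → ℕ) : coeffAt m (MvPowerSeries.rename σ f) = coeffAt (m ∘ σ) f := by
  have h := MvPowerSeries.coeff_embDomain_rename σ.toEmbedding f
    (Finsupp.equivFunOnFinite.symm (m ∘ σ))
  unfold coeffAt
  rw [← h]
  congr 1
  congr 1
  ext k
  obtain ⟨k, rfl⟩ := σ.surjective k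
  have := Finsupp.embDomain_apply_self σ.toEmbedding (Finsupp.equivFunOnFinite.symm (m ∘ σ)) k
  simp only [Equiv.coe_toEmbedding, Finsupp.equivFunOnFinite_symm_apply_apply,
    Function.comp_apply] at this ⊢
  exact this.symm

/-- When `2` is not a zero divisor, it is enough that permutations of the variables act by the
sign. -/
theorem isAlternating_of_rename (h2 : ∀ a : R, 2 * a = 0 → a = 0) {f : MvPowerSeries (Fin n) R}
    (h : ∀ σ : Equiv.Perm (Fin n),
      MvPowerSeries.rename σ f = ((Equiv.Perm.sign σ : ℤ) : R) • f) : IsAlternating f := by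
  have h1 : ∀ (m : Fin n → ℕ) (σ : Equiv.Perm (Fin n)),
      coeffAt (m ∘ σ) f = ((Equiv.Perm.sign σ : ℤ) : R) * coeffAt m f := fun m σ => by
    rw [← coeffAt_rename_perm, h, map_smul, smul_eq_mul]
  refine ⟨h1, fun m hm => ?_⟩
  simp only [Function.Injective, not_forall] at hm
  obtain ⟨i, j, hij, hne⟩ := hm
  have hswap := h1 m (Equiv.swap i j)
  rw [Equiv.Perm.sign_swap hne] at hswap
  have h3 : m ∘ Equiv.swap i j = m := by
    ext k
    rcases eq_or_ne k i with rfl | hki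
    · simp [hij]
    rcases eq_or_ne k j with rfl | hkj
    · simp [hij]
    simp [Equiv.swap_apply_of_ne_of_ne hki hkj]
  rw [h3] at hswap
  refine h2 _ ?_
  push_cast at hswap
  linear_combination hswap

end Alternating

/-! ### Series in one of the variables, and alternants -/

section Alternant

variable {R : Type*} [CommRing R] {n : ℕ}

/-- The series `G(t_k)`, for a power series `G` in one variable. -/
noncomputable def inVar (k : Fin n) : PowerSeries R →ₐ[R] MvPowerSeries (Fin n) R :=
  MvPowerSeries.rename fun _ : Unit => k

theorem inVar_X (k : Fin n) : inVar k (PowerSeries.X : PowerSeries R) = MvPowerSeries.X k :=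
  MvPowerSeries.rename_X _ _

theorem coeff_inVar_single (k : Fin n) (G : PowerSeries R) (d : ℕ) :
    MvPowerSeries.coeff (Finsupp.single k d) (inVar k G) = PowerSeries.coeff d G := by
  have h := MvPowerSeries.coeff_embDomain_rename
    (⟨fun _ : Unit => k, Function.injective_of_subsingleton _⟩ : Unit ↪ Fin n) G
    (Finsupp.single () d)
  rw [Finsupp.embDomain_single] at h
  exact h

theorem coeff_inVar_eq_zero (k : Fin n) (G : PowerSeries R) (m : Fin n →₀ ℕ)
    (hm : ∀ d, m ≠ Finsupp.single k d) : MvPowerSeries.coeff m (inVar k G) = 0 := by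
  refine MvPowerSeries.coeff_rename_eq_zero _ _ ?_
  rintro ⟨x, rfl⟩
  refine hm (x ()) ?_
  rw [Finsupp.unique_single x, Finsupp.mapDomain_single, Finsupp.single_eq_same]

theorem coeffAt_prod_inVar (G : Fin n → PowerSeries R) (m : Fin n → ℕ) :
    coeffAt m (∏ k, inVar k (G k)) = ∏ k, PowerSeries.coeff (m k) (G k) := by
  classical
  rw [coeffAt, MvPowerSeries.coeff_prod]
  rw [Finset.sum_eq_single (Finsupp.equivFunOnFinite.symm fun k => Finsupp.single k (m k))]
  · simp [coeff_inVar_single]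
  · intro l hl hne
    by_contra hprod
    refine hne ?_
    have hk : ∀ k, ∃ d, l k = Finsupp.single k d := by
      intro k
      by_contra hcon
      push Not at hcon
      exact hprod (Finset.prod_eq_zero (Finset.mem_univ k) (coeff_inVar_eq_zero k _ _ hcon))
    choose d hd using hk
    rw [Finset.mem_finsuppAntidiag] at hl
    ext k i
    have h1 := DFunLike.congr_fun hl.1 k
    simp only [Finsupp.coe_finsetSum, Finset.sum_apply, hd,
      Finsupp.equivFunOnFinite_symm_apply_apply] at h1
    rw [Finset.sum_eq_single k (fun b _ hb => Finsupp.single_eq_of_ne hb.symm) (by simp),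
      Finsupp.single_eq_same] at h1
    simp [hd, h1]
  · intro h
    refine absurd ?_ h
    rw [Finset.mem_finsuppAntidiag]
    refine ⟨?_, Finset.subset_univ _⟩
    ext k
    simp only [Finsupp.coe_finsetSum, Finset.sum_apply,
      Finsupp.equivFunOnFinite_symm_apply_apply]
    rw [Finset.sum_eq_single k (fun b _ hb => Finsupp.single_eq_of_ne hb.symm) (by simp),
      Finsupp.single_eq_same]

/-- The coefficient of `T^m` in `det (G_j(t_k))` is `det ([t^{m_k}] G_j)`. -/
theorem coeffAt_det_inVar (G : Fin n → PowerSeries R) (m : Fin n → ℕ) :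
    coeffAt m (Matrix.det (Matrix.of fun k j : Fin n => inVar k (G j))) =
      Matrix.det (Matrix.of fun k j : Fin n => PowerSeries.coeff (m k) (G j)) := by
  rw [← Matrix.det_transpose, ← Matrix.det_transpose (Matrix.of fun k j : Fin n => _),
    Matrix.det_apply, Matrix.det_apply, map_sum]
  refine Finset.sum_congr rfl fun σ _ => ?_
  rw [Units.smul_def, Units.smul_def, map_zsmul]
  congr 1
  simp only [Matrix.transpose_apply, Matrix.of_apply]
  exact coeffAt_prod_inVar (fun k => G (σ k)) m

theorem isAlternating_det_inVar (G : Fin n → PowerSeries R) :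
    IsAlternating (Matrix.det (Matrix.of fun k j : Fin n => inVar k (G j))) := by
  refine ⟨fun m σ => ?_, fun m hm => ?_⟩
  · rw [coeffAt_det_inVar, coeffAt_det_inVar]
    exact Matrix.det_permute σ (Matrix.of fun k j : Fin n => PowerSeries.coeff (m k) (G j))
  · rw [coeffAt_det_inVar]
    simp only [Function.Injective, not_forall] at hm
    obtain ⟨i, j, hij, hne⟩ := hm
    refine Matrix.det_zero_of_row_eq hne ?_
    ext l
    simp [hij]

/-- The alternant `a_{λ+δ}(T) = det (t_k^{λ_j + n - 1 - j})`. -/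
noncomputable def alternant (R : Type*) [CommRing R] (n : ℕ) (lam : YoungDiagram) :
    MvPowerSeries (Fin n) R :=
  Matrix.det (Matrix.of fun k j : Fin n =>
    (MvPowerSeries.X k : MvPowerSeries (Fin n) R) ^ shifted n lam j)

theorem alternant_eq (lam : YoungDiagram) : alternant R n lam =
    Matrix.det (Matrix.of fun k j : Fin n =>
      inVar k ((PowerSeries.X : PowerSeries R) ^ shifted n lam j)) := by
  simp only [alternant, map_pow, inVar_X]

theorem isAlternating_alternant (lam : YoungDiagram) : IsAlternating (alternant R n lam) := by
  rw [alternant_eq]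
  exact isAlternating_det_inVar _

open scoped Classical in
theorem coeffAt_alternant {lam mu : YoungDiagram} (hl : lam.colLen 0 ≤ n)
    (hm : mu.colLen 0 ≤ n) :
    coeffAt (shifted n mu) (alternant R n lam) = if mu = lam then 1 else 0 := by
  rw [alternant_eq, coeffAt_det_inVar]
  simp only [PowerSeries.coeff_X_pow]
  split_ifs with h
  · subst h
    convert Matrix.det_one (n := Fin n) (R := R)
    ext k j
    simp only [Matrix.of_apply, Matrix.one_apply, (shifted_strictAnti n mu).injective.eq_iff]
  · rw [← Matrix.det_transpose, Matrix.det_apply]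
    refine Finset.sum_eq_zero fun σ _ => ?_
    suffices ∃ k, shifted n mu k ≠ shifted n lam (σ k) by
      obtain ⟨k, hk⟩ := this
      rw [Finset.prod_eq_zero (Finset.mem_univ k), smul_zero]
      simp [hk]
    by_contra! hcon
    refine h (shifted_injective hm hl (funext fun k => ?_))
    -- a permutation relating two strictly decreasing vectors is increasing, hence trivial
    have hmono : StrictMono σ := fun i j hij => by
      have := shifted_strictAnti n mu hij
      rw [hcon, hcon] at this
      exact (shifted_strictAnti n lam).lt_iff_gt.1 this
    have hid : σ k = k := by
      have : (⇑σ) = id := (hmono.range_inj strictMono_id).1 (by simp [σ.surjective.range_eq])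
      rw [this]; rfl
    rw [hcon, hid]

/-- The Vandermonde product `V = det (t_k^{n - 1 - j})`. -/
noncomputable def vdm {A : Type*} [CommRing A] {n : ℕ} (t : Fin n → A) : A :=
  Matrix.det (Matrix.of fun k j : Fin n => t k ^ (j.rev : ℕ))

theorem rowLen_bot (i : ℕ) : (⊥ : YoungDiagram).rowLen i = 0 := by
  by_contra h
  exact YoungDiagram.notMem_bot _ (YoungDiagram.mem_iff_lt_rowLen.2 (Nat.pos_of_ne_zero h))

theorem colLen_bot (i : ℕ) : (⊥ : YoungDiagram).colLen i = 0 := by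
  by_contra h
  exact YoungDiagram.notMem_bot _ (YoungDiagram.mem_iff_lt_colLen.2 (Nat.pos_of_ne_zero h))

theorem alternant_bot :
    alternant R n ⊥ = vdm (MvPowerSeries.X : Fin n → MvPowerSeries (Fin n) R) := by
  simp only [alternant, vdm, shifted, rowLen_bot, zero_add]

/-- An alternating series agrees, up to degree `N + |δ|`, with the combination of alternants
`a_{λ+δ}`, `|λ| ≤ N`, whose coefficients are read off at the exponents `λ + δ`. -/
theorem IsAlternating.coeffAt_eq_sum_alternant {f : MvPowerSeries (Fin n) R}
    (hf : IsAlternating f) {N : ℕ} (hN : N ≤ n) (m : Fin n → ℕ)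
    (hm : ∑ k, m k ≤ N + ∑ k : Fin n, (k.rev : ℕ)) :
    coeffAt m f =
      coeffAt m (∑ lam ∈ partsLE N,
        MvPowerSeries.C (coeffAt (shifted n lam) f) * alternant R n lam) := by
  classical
  simp only [← MvPowerSeries.smul_eq_C_mul]
  have hlen : ∀ lam ∈ partsLE N, lam.colLen 0 ≤ n := fun lam h =>
    (colLen_zero_le_card lam).trans ((mem_partsLE.1 h).trans hN)
  refine hf.coeffAt_eq
    (isAlternating_sum _ _ fun lam _ => (isAlternating_alternant lam).smul _) ?_ m hm
  intro lam hl hcard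
  rw [map_sum, Finset.sum_eq_single lam]
  · simp [coeffAt_alternant hl hl]
  · intro mu hmu hne
    simp [coeffAt_alternant (hlen mu hmu) hl, hne.symm]
  · intro h
    exact absurd (mem_partsLE.2 hcard) h

end Alternant

/-! ### Jacobi-Trudi determinants of size `n` -/

section Determinants

variable {A : Type*} [CommRing A]

/-- The coefficients of a power series, extended by `0` to negative indices. -/
noncomputable def seqOf (G : PowerSeries A) (m : ℤ) : A :=
  if 0 ≤ m then PowerSeries.coeff m.toNat G else 0

theorem seqOf_of_neg (G : PowerSeries A) {m : ℤ} (hm : m < 0) : seqOf G m = 0 := by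
  rw [seqOf, if_neg (not_le.2 hm)]

theorem seqOf_zero (G : PowerSeries A) : seqOf G 0 = PowerSeries.constantCoeff G := by
  simp [seqOf]

theorem coeff_X_pow_mul_eq_seqOf (a d : ℕ) (G : PowerSeries A) :
    PowerSeries.coeff d (PowerSeries.X ^ a * G) = seqOf G ((d : ℤ) - a) := by
  rw [PowerSeries.coeff_X_pow_mul', seqOf]
  by_cases h : a ≤ d
  · rw [if_pos h, if_pos (by omega), show ((d : ℤ) - a).toNat = d - a by omega]
  · rw [if_neg h, if_neg (by omega)]

theorem coeff_coe_mul_eq_sum_seqOf {n : ℕ} (p : Polynomial A) (hp : p.natDegree < n)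
    (G : PowerSeries A) (d : ℕ) :
    PowerSeries.coeff d ((p : PowerSeries A) * G) =
      ∑ r : Fin n, p.coeff r * seqOf G ((d : ℤ) - (r : ℕ)) := by
  conv_lhs => rw [p.as_sum_range' n hp]
  have : ((∑ i ∈ Finset.range n, Polynomial.monomial i (p.coeff i) : Polynomial A) :
      PowerSeries A) = ∑ i ∈ Finset.range n,
        PowerSeries.C (p.coeff i) * PowerSeries.X ^ i := by
    rw [← Polynomial.coeToPowerSeries.ringHom_apply, map_sum]
    refine Finset.sum_congr rfl fun i _ => ?_
    rw [← Polynomial.C_mul_X_pow_eq_monomial, map_mul, map_pow]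
    simp
  rw [this, Finset.sum_mul, map_sum, ← Fin.sum_univ_eq_sum_range
    (fun i => PowerSeries.coeff d (PowerSeries.C (p.coeff i) * PowerSeries.X ^ i * G))]
  refine Finset.sum_congr rfl fun i _ => ?_
  rw [mul_assoc, PowerSeries.coeff_C_mul, coeff_X_pow_mul_eq_seqOf]

/-- A determinant whose rows from the index `l` on are unitriangular does not depend on its size. -/
theorem det_eq_det_of_unitriangular (e : ℕ → ℕ → A) {l n : ℕ} (hln : l ≤ n)
    (h0 : ∀ i j, l ≤ i → j < i → e i j = 0) (h1 : ∀ i, l ≤ i → e i i = 1) :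
    Matrix.det (Matrix.of fun i j : Fin n => e i j) =
      Matrix.det (Matrix.of fun i j : Fin l => e i j) := by
  induction n, hln using Nat.le_induction with
  | base => rfl
  | succ n hln ih =>
    rw [← ih, Matrix.det_succ_row _ (Fin.last n), Fin.sum_univ_castSucc,
      Finset.sum_eq_zero, zero_add]
    · simp only [Matrix.of_apply, Fin.val_last, h1 n hln, ← two_mul, Even.neg_pow (even_two_mul n),
        one_pow, one_mul]
      congr 1
      ext i j
      simp [Matrix.submatrix_apply, Fin.succAbove_last]
    · intro j _
      simp only [Matrix.of_apply, Fin.val_last, Fin.val_castSucc, h0 n j hln j.2, mul_zero,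
        zero_mul]

theorem jacobiTrudi_eq_det (h : ℤ → A) (hneg : ∀ m < 0, h m = 0) (h1 : h 0 = 1)
    {lam : YoungDiagram} {n : ℕ} (hl : lam.colLen 0 ≤ n) :
    jacobiTrudi h lam = Matrix.det (Matrix.of fun i j : Fin n =>
      h ((lam.rowLen i : ℤ) - (i : ℕ) + (j : ℕ))) := by
  refine (det_eq_det_of_unitriangular
    (fun i j => h ((lam.rowLen i : ℤ) - (i : ℤ) + (j : ℤ))) hl ?_ ?_).symm
  · intro i j hi hj
    simp only [rowLen_eq_zero_of_colLen_le hi]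
    exact hneg _ (by push_cast; omega)
  · intro i hi
    simp only [rowLen_eq_zero_of_colLen_le hi]
    simpa using h1

theorem jacobiTrudiOrth_eq_det (h : ℤ → A) (hneg : ∀ m < 0, h m = 0) (h1 : h 0 = 1)
    {lam : YoungDiagram} {n : ℕ} (hl : lam.colLen 0 ≤ n) :
    jacobiTrudiOrth h lam = Matrix.det (Matrix.of fun i j : Fin n =>
      h ((lam.rowLen i : ℤ) - (i : ℕ) + (j : ℕ)) -
        h ((lam.rowLen i : ℤ) - (i : ℕ) - (j : ℕ) - 2)) := by
  refine (det_eq_det_of_unitriangular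
    (fun i j => h ((lam.rowLen i : ℤ) - (i : ℤ) + (j : ℤ)) -
      h ((lam.rowLen i : ℤ) - (i : ℤ) - (j : ℤ) - 2)) hl ?_ ?_).symm
  · intro i j hi hj
    simp only [rowLen_eq_zero_of_colLen_le hi]
    rw [hneg _ (by push_cast; omega), hneg _ (by push_cast; omega), sub_zero]
  · intro i hi
    simp only [rowLen_eq_zero_of_colLen_le hi]
    rw [hneg (_ - 2) (by push_cast; omega)]
    simpa using h1

/-- For the empty partition and `n > 0`, the determinant on the right is `2`. -/
theorem jacobiTrudiSymp_eq_det [Invertible (2 : A)] (h : ℤ → A) (hneg : ∀ m < 0, h m = 0)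
    (h1 : h 0 = 1) {lam : YoungDiagram} {n : ℕ} (hl : lam.colLen 0 ≤ n) (hn : 0 < n) :
    jacobiTrudiSymp h lam = ⅟(2 : A) * Matrix.det (Matrix.of fun i j : Fin n =>
      h ((lam.rowLen i : ℤ) - (i : ℕ) + (j : ℕ)) +
        h ((lam.rowLen i : ℤ) - (i : ℕ) - (j : ℕ))) := by
  have key : ∀ l, 0 < l → lam.colLen 0 ≤ l → l ≤ n → Matrix.det (Matrix.of fun i j : Fin n =>
      h ((lam.rowLen i : ℤ) - (i : ℕ) + (j : ℕ)) +
        h ((lam.rowLen i : ℤ) - (i : ℕ) - (j : ℕ))) =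
      Matrix.det (Matrix.of fun i j : Fin l =>
      h ((lam.rowLen i : ℤ) - (i : ℕ) + (j : ℕ)) +
        h ((lam.rowLen i : ℤ) - (i : ℕ) - (j : ℕ))) := by
    intro l hl0 hcl hln
    refine det_eq_det_of_unitriangular
      (fun i j => h ((lam.rowLen i : ℤ) - (i : ℤ) + (j : ℤ)) +
        h ((lam.rowLen i : ℤ) - (i : ℤ) - (j : ℤ))) hln ?_ ?_
    · intro i j hi hj
      simp only [rowLen_eq_zero_of_colLen_le (hcl.trans hi)]
      rw [hneg _ (by push_cast; omega), hneg _ (by push_cast; omega), add_zero]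
    · intro i hi
      simp only [rowLen_eq_zero_of_colLen_le (hcl.trans hi)]
      rw [hneg (_ - _ - _) (by push_cast; omega)]
      simpa using h1
  unfold jacobiTrudiSymp
  split_ifs with hbot
  · subst hbot
    rw [key 1 one_pos (by rw [colLen_bot]; omega) hn]
    simp [h1, rowLen_bot, one_add_one_eq_two]
  · have hpos : 0 < lam.colLen 0 := by
      rw [Nat.pos_iff_ne_zero]
      intro h0
      exact hbot (ext_rowLen fun i => by
        rw [rowLen_bot, rowLen_eq_zero_of_colLen_le (by omega)])
    rw [key _ hpos le_rfl hl]

theorem map_jacobiTrudi {B : Type*} [CommRing B] (φ : A →+* B) (h : ℤ → A) (lam : YoungDiagram) :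
    φ (jacobiTrudi h lam) = jacobiTrudi (fun m => φ (h m)) lam := by
  rw [jacobiTrudi, jacobiTrudi, RingHom.map_det]
  rfl

end Determinants

/-! ### Complete symmetric series and the bialternant formula -/

section Complete

variable {σ : Type*} {R : Type*} [CommRing R]

open scoped Classical in
/-- The sum of all monomials of degree `d` in the variables of `S`. -/
noncomputable def homOn (R : Type*) [CommRing R] (S : Finset σ) (d : ℕ) : MvPowerSeries σ R :=
  fun m => if m.degree = d ∧ m.support ⊆ S then 1 else 0

open scoped Classical in
theorem coeff_homOn (S : Finset σ) (d : ℕ) (m : σ →₀ ℕ) :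
    MvPowerSeries.coeff m (homOn R S d) = if m.degree = d ∧ m.support ⊆ S then 1 else 0 :=
  rfl

theorem oneSub_mul_mk_homOn [DecidableEq σ] {S : Finset σ} {a : σ} (ha : a ∉ S) :
    oneSub (MvPowerSeries.X a : MvPowerSeries σ R) * PowerSeries.mk (homOn R (insert a S)) =
      PowerSeries.mk (homOn R S) := by
  ext d : 1
  rw [oneSub, sub_mul, one_mul, map_sub, mul_assoc, PowerSeries.coeff_C_mul, PowerSeries.coeff_mk,
    PowerSeries.coeff_mk]
  rcases d with _ | d
  · rw [PowerSeries.coeff_zero_X_mul, mul_zero, sub_zero]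
    ext m
    rw [coeff_homOn, coeff_homOn]
    congr 1
    simp only [eq_iff_iff, and_congr_right_iff, Finsupp.degree_eq_zero_iff]
    rintro rfl
    simp
  · rw [PowerSeries.coeff_succ_X_mul, PowerSeries.coeff_mk]
    ext m
    rw [map_sub, MvPowerSeries.X, MvPowerSeries.coeff_monomial_mul, coeff_homOn, coeff_homOn,
      coeff_homOn, one_mul]
    by_cases hm : m a = 0
    · rw [if_neg (c := Finsupp.single a 1 ≤ m), sub_zero]
      · congr 1
        rw [eq_iff_iff, and_congr_right_iff]
        intro _
        rw [Finset.subset_insert_iff_of_notMem (by simpa using hm)]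
      · intro hle
        have := hle a
        simp [hm] at this
    · have hle : Finsupp.single a 1 ≤ m := by
        rw [Finsupp.single_le_iff]
        omega
      obtain ⟨m', rfl⟩ := exists_add_of_le hle
      rw [if_pos hle, add_tsub_cancel_left, map_add, Finsupp.degree_single]
      rw [if_neg (c := _ ∧ _ ⊆ S) (fun h => ha (h.2 (by simp))), sub_eq_zero]
      congr 1
      rw [eq_iff_iff]
      refine and_congr (by omega) ⟨fun h => ?_, fun h => ?_⟩
      · intro i hi
        refine h ?_
        simp only [Finsupp.mem_support_iff, Finsupp.add_apply] at hi ⊢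
        omega
      · intro i hi
        rcases eq_or_ne i a with rfl | hia
        · simp
        · refine h ?_
          simpa [Finsupp.single_apply, hia.symm] using hi

theorem prod_oneSub_mul_mk_homOn [DecidableEq σ] (S : Finset σ) :
    (∏ i ∈ S, oneSub (MvPowerSeries.X i : MvPowerSeries σ R)) * PowerSeries.mk (homOn R S) = 1 := by
  induction S using Finset.induction_on with
  | empty =>
    rw [Finset.prod_empty, one_mul]
    ext d m
    rw [PowerSeries.coeff_mk, coeff_homOn, PowerSeries.coeff_one]
    simp only [Finset.subset_empty, Finsupp.support_eq_empty]
    split_ifs with h1 h2 h2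
    · rw [h1.2]; simp
    · exact absurd h1.1 (by rw [h1.2, map_zero]; exact Ne.symm h2)
    · rw [MvPowerSeries.coeff_one, if_neg]
      rintro rfl
      exact h1 ⟨by simp [h2], rfl⟩
    · simp
  | insert a S ha ih =>
    rw [Finset.prod_insert ha, mul_comm (oneSub _), mul_assoc, oneSub_mul_mk_homOn ha, ih]

theorem oneSub_mul_mk_pow {A : Type*} [CommRing A] (a : A) :
    oneSub a * PowerSeries.mk (fun d => a ^ d) = 1 := by
  ext d
  rw [oneSub, sub_mul, one_mul, map_sub, mul_assoc, PowerSeries.coeff_C_mul, PowerSeries.coeff_mk]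
  rcases d with _ | d
  · simp
  · rw [PowerSeries.coeff_succ_X_mul, PowerSeries.coeff_mk, PowerSeries.coeff_one]
    simp [pow_succ']

variable {n : ℕ}

/-- The generating function of the complete symmetric functions of `n` variables. -/
noncomputable def homGen (R : Type*) [CommRing R] (n : ℕ) :
    PowerSeries (MvPowerSeries (Fin n) R) :=
  PowerSeries.mk (homOn R Finset.univ)

/-- The Schur polynomial in `n` variables over `R`, as a power series. -/
noncomputable def schurSeries (R : Type*) [CommRing R] (n : ℕ) (lam : YoungDiagram) :
    MvPowerSeries (Fin n) R :=
  jacobiTrudi (seqOf (homGen R n)) lam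

theorem constantCoeff_homGen : PowerSeries.constantCoeff (homGen R n) = 1 := by
  rw [homGen, ← PowerSeries.coeff_zero_eq_constantCoeff_apply, PowerSeries.coeff_mk]
  ext m
  rw [coeff_homOn, MvPowerSeries.coeff_one]
  simp [Finsupp.degree_eq_zero_iff]

/-- Multiplying `∏_i (1 - t_i z)⁻¹` by all factors but the one of `t_k` leaves `∑ t_k^d z^d`. -/
theorem prod_erase_mul_homGen (k : Fin n) :
    (∏ i ∈ Finset.univ.erase k, oneSub (MvPowerSeries.X i : MvPowerSeries (Fin n) R)) *
      homGen R n = PowerSeries.mk fun d => (MvPowerSeries.X k : MvPowerSeries (Fin n) R) ^ d := by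
  have h1 := prod_oneSub_mul_mk_homOn (R := R) (Finset.univ : Finset (Fin n))
  rw [← Finset.mul_prod_erase _ _ (Finset.mem_univ k)] at h1
  have h2 := oneSub_mul_mk_pow (MvPowerSeries.X k : MvPowerSeries (Fin n) R)
  rw [homGen]
  linear_combination (PowerSeries.mk fun d => (MvPowerSeries.X k : MvPowerSeries (Fin n) R) ^ d)
    * h1 - ((∏ i ∈ Finset.univ.erase k, oneSub (MvPowerSeries.X i : MvPowerSeries (Fin n) R)) *
      PowerSeries.mk (homOn R Finset.univ)) * h2

/-- The bialternant formula `a_{λ+δ} = V s_λ`: by `prod_erase_mul_homGen`, the matrix of the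
alternant is the product of a matrix independent of `λ` with the Jacobi-Trudi matrix. -/
theorem alternant_eq_vdm_mul {lam : YoungDiagram} (hl : lam.colLen 0 ≤ n) :
    alternant R n lam = vdm (MvPowerSeries.X : Fin n → MvPowerSeries (Fin n) R) *
      schurSeries R n lam := by
  let p : Fin n → Polynomial (MvPowerSeries (Fin n) R) := fun k =>
    ∏ i ∈ Finset.univ.erase k, (1 - Polynomial.C (MvPowerSeries.X i) * Polynomial.X)
  have hp : ∀ k, ((p k : Polynomial _) : PowerSeries (MvPowerSeries (Fin n) R)) =
      ∏ i ∈ Finset.univ.erase k, oneSub (MvPowerSeries.X i : MvPowerSeries (Fin n) R) := by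
    intro k
    rw [← Polynomial.coeToPowerSeries.ringHom_apply, map_prod]
    refine Finset.prod_congr rfl fun i _ => ?_
    simp [oneSub]
  have hdeg : ∀ k, (p k).natDegree < n := by
    intro k
    refine (Polynomial.natDegree_prod_le _ _).trans_lt ?_
    refine (Finset.sum_le_card_nsmul _ _ 1 fun i _ => ?_).trans_lt ?_
    · refine (Polynomial.natDegree_sub_le _ _).trans ?_
      simp only [Polynomial.natDegree_one, zero_le, sup_of_le_right]
      exact (Polynomial.natDegree_C_mul_le _ _).trans Polynomial.natDegree_X_le
    · rw [Finset.card_erase_of_mem (Finset.mem_univ k), Finset.card_univ, Fintype.card_fin]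
      have := k.2
      simp only [smul_eq_mul, mul_one]
      omega
  let M : Matrix (Fin n) (Fin n) (MvPowerSeries (Fin n) R) :=
    Matrix.of fun k l => (p k).coeff (l.rev : ℕ)
  have key : ∀ mu : YoungDiagram, mu.colLen 0 ≤ n →
      alternant R n mu = M.det * schurSeries R n mu := by
    intro mu hmu
    rw [schurSeries, jacobiTrudi_eq_det _ (fun m hm => seqOf_of_neg _ hm)
      (by rw [seqOf_zero, constantCoeff_homGen]) hmu,
      ← Matrix.det_transpose (Matrix.of fun i j : Fin n =>
        seqOf (homGen R n) ((mu.rowLen i : ℤ) - (i : ℕ) + (j : ℕ))), ← Matrix.det_mul, alternant]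
    congr 1
    ext k j : 1
    have h1 := coeff_coe_mul_eq_sum_seqOf (p k) (hdeg k) (homGen R n) (shifted n mu j)
    rw [hp, prod_erase_mul_homGen, PowerSeries.coeff_mk] at h1
    rw [Matrix.of_apply, h1, Matrix.mul_apply, ← Equiv.sum_comp Fin.revPerm]
    refine Finset.sum_congr rfl fun l _ => ?_
    have hj := j.2
    have hl := l.2
    have hidx : ((shifted n mu j : ℕ) : ℤ) - ((Fin.revPerm l : Fin n) : ℕ) =
        (mu.rowLen j : ℤ) - (j : ℕ) + (l : ℕ) := by
      simp only [Fin.revPerm_apply, shifted, Fin.val_rev]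
      omega
    rw [hidx]
    rfl
  have hM : M.det = vdm (MvPowerSeries.X : Fin n → MvPowerSeries (Fin n) R) := by
    have h1 := key ⊥ (by rw [colLen_bot]; exact Nat.zero_le _)
    rw [alternant_bot] at h1
    have : IsEmpty (Fin ((⊥ : YoungDiagram).colLen 0)) := by
      rw [colLen_bot]; infer_instance
    rw [h1, schurSeries, jacobiTrudi,
      Matrix.det_isEmpty (n := Fin ((⊥ : YoungDiagram).colLen 0)), mul_one]
  rw [key lam hl, hM]

/-- Setting the superfluous variables to `0`. -/
theorem killCompl_schurSeries {n' : ℕ} (e : Fin n' ↪ Fin n) (lam : YoungDiagram) :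
    MvPowerSeries.killCompl (R := R) e (schurSeries R n lam) = schurSeries R n' lam := by
  have h := map_jacobiTrudi (MvPowerSeries.killCompl (R := R) e).toRingHom
    (seqOf (homGen R n)) lam
  refine h.trans ?_
  rw [schurSeries]
  congr 1
  funext m
  simp only [seqOf, homGen, PowerSeries.coeff_mk]
  split_ifs with hm
  · ext x
    rw [AlgHom.toRingHom_eq_coe, RingHom.coe_coe, MvPowerSeries.coeff_killCompl, coeff_homOn,
      coeff_homOn]
    simp [Finsupp.embDomain_eq_mapDomain, Finsupp.degree_mapDomain]
  · simp

theorem map_schurSeries {S : Type*} [CommRing S] (φ : R →+* S) (lam : YoungDiagram) :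
    MvPowerSeries.map φ (schurSeries R n lam) = schurSeries S n lam := by
  rw [schurSeries, map_jacobiTrudi, schurSeries]
  congr 1
  funext m
  simp only [seqOf, homGen, PowerSeries.coeff_mk]
  split_ifs with hm
  · ext x
    rw [MvPowerSeries.coeff_map, coeff_homOn, coeff_homOn]
    split_ifs <;> simp
  · simp

theorem coeff_hsymm (d : ℕ) (m : Fin n →₀ ℕ) :
    MvPolynomial.coeff m (MvPolynomial.hsymm (Fin n) ℤ d) = if m.degree = d then 1 else 0 := by
  have hprod : ∀ s : Sym (Fin n) d, (s.1.map (MvPolynomial.X (R := ℤ))).prod =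
      MvPolynomial.monomial ((Sym.equivNatSum (Fin n) d s : Fin n →₀ ℕ)) 1 := by
    intro s
    have h1 : s.1 = Finsupp.toMultiset (Sym.equivNatSum (Fin n) d s : Fin n →₀ ℕ) := by
      rw [← Sym.coe_equivNatSum_symm_apply, Equiv.symm_apply_apply]
      rfl
    rw [MvPolynomial.monomial_eq, MvPolynomial.C_1, one_mul]
    conv_lhs => rw [h1]
    rw [Finsupp.toMultiset_map, Finsupp.prod_toMultiset, Finsupp.prod_mapDomain_index
      (by simp) (by intros; exact pow_add _ _ _)]
  have hdeg : ∀ P : Fin n →₀ ℕ, P.sum (fun _ => id) = P.degree := fun P => rfl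
  rw [MvPolynomial.hsymm, MvPolynomial.coeff_sum]
  simp only [hprod, MvPolynomial.coeff_monomial, ← hdeg]
  split_ifs with h
  · rw [Finset.sum_eq_single ((Sym.equivNatSum (Fin n) d).symm ⟨m, h⟩)]
    · simp
    · intro s _ hs
      rw [if_neg]
      rintro rfl
      exact hs (by simp)
    · simp
  · refine Finset.sum_eq_zero fun s _ => ?_
    rw [if_neg]
    intro hs
    rw [← hs] at h
    exact h (Sym.equivNatSum (Fin n) d s).2

theorem coe_schurPoly (lam : YoungDiagram) :
    (schurPoly n lam : MvPowerSeries (Fin n) ℤ) = schurSeries ℤ n lam := by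
  have h := map_jacobiTrudi (MvPolynomial.coeToMvPowerSeries.ringHom (σ := Fin n) (R := ℤ))
    (fun m : ℤ => if 0 ≤ m then MvPolynomial.hsymm (Fin n) ℤ m.toNat else 0) lam
  refine Eq.trans ?_ (h.trans ?_)
  · rfl
  rw [schurSeries]
  congr 1
  funext m
  simp only [seqOf, homGen, PowerSeries.coeff_mk]
  split_ifs with hm
  · ext x
    rw [MvPolynomial.coeToMvPowerSeries.ringHom_apply, MvPolynomial.coeff_coe, coeff_hsymm,
      coeff_homOn]
    simp
  · simp

theorem isHomogeneous_hsymm (d : ℕ) : (MvPolynomial.hsymm (Fin n) ℤ d).IsHomogeneous d := by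
  intro m hm
  rw [coeff_hsymm] at hm
  refine (DFunLike.congr_fun Finsupp.degree_eq_weight_one m).symm.trans ?_
  by_contra h
  exact hm (if_neg h)

theorem isHomogeneous_schurPoly (lam : YoungDiagram) :
    (schurPoly n lam).IsHomogeneous lam.card := by
  rw [schurPoly, jacobiTrudi, ← Matrix.det_transpose, Matrix.det_apply]
  refine MvPolynomial.IsHomogeneous.sum _ _ _ fun σ _ => ?_
  rw [Units.smul_def, zsmul_eq_mul]
  have hC : ((Equiv.Perm.sign σ : ℤ) : MvPolynomial (Fin n) ℤ) =
      MvPolynomial.C (Equiv.Perm.sign σ : ℤ) := by simp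
  rw [hC]
  refine MvPolynomial.IsHomogeneous.C_mul ?_ _
  simp only [Matrix.transpose_apply, Matrix.of_apply]
  by_cases hneg : ∃ i : Fin (lam.colLen 0), ¬ 0 ≤ (lam.rowLen i : ℤ) - (i : ℕ) + (σ i : ℕ)
  · obtain ⟨i, hi⟩ := hneg
    rw [Finset.prod_eq_zero (Finset.mem_univ i) (if_neg hi)]
    exact MvPolynomial.isHomogeneous_zero _ _ _
  · push Not at hneg
    have hsum : lam.card = ∑ i : Fin (lam.colLen 0),
        ((lam.rowLen i : ℤ) - (i : ℕ) + (σ i : ℕ)).toNat := by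
      have h1 := card_eq_sum_rowLen (le_refl (lam.colLen 0))
      zify
      rw [Finset.sum_congr rfl fun i _ => Int.toNat_of_nonneg (hneg i), Finset.sum_add_distrib,
        Finset.sum_sub_distrib, Equiv.sum_comp σ (fun i : Fin (lam.colLen 0) => ((i : ℕ) : ℤ)), h1]
      push_cast
      ring
    rw [hsum]
    refine MvPolynomial.IsHomogeneous.prod _ _ _ fun i _ => ?_
    rw [if_pos (hneg i)]
    exact isHomogeneous_hsymm _

end Complete

/-! ### Littlewood-Richardson coefficients as coefficients of alternating polynomials -/

section LittlewoodRichardson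

variable {R : Type*} [CommRing R] {n : ℕ}

theorem degree_equivFunOnFinite_symm (m : Fin n → ℕ) :
    (Finsupp.equivFunOnFinite.symm m).degree = ∑ k, m k := by
  rw [Finsupp.degree_eq_sum]
  rfl

theorem coeffAt_eq_zero_of_isHomogeneous {f : MvPowerSeries (Fin n) R} {p : ℕ}
    (hf : f.IsHomogeneous p) {m : Fin n → ℕ} (hm : ∑ k, m k ≠ p) : coeffAt m f = 0 :=
  hf.coeff_eq_zero (by rwa [degree_equivFunOnFinite_symm])

theorem isHomogeneous_of_coeffAt {f : MvPowerSeries (Fin n) R} {p : ℕ}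
    (h : ∀ m, ∑ k, m k ≠ p → coeffAt m f = 0) : f.IsHomogeneous p := by
  intro d hd
  refine (DFunLike.congr_fun Finsupp.degree_eq_weight_one d).symm.trans ?_
  by_contra hne
  rw [coeff_eq_coeffAt] at hd
  exact hd (h _ (by rwa [Finsupp.degree_eq_sum] at hne))

theorem isHomogeneous_schurSeries (lam : YoungDiagram) :
    (schurSeries ℤ n lam).IsHomogeneous lam.card := by
  intro d hd
  rw [← coe_schurPoly, MvPolynomial.coeff_coe] at hd
  exact isHomogeneous_schurPoly lam hd

theorem isHomogeneous_alternant {lam : YoungDiagram} (hl : lam.colLen 0 ≤ n) :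
    (alternant R n lam).IsHomogeneous (lam.card + ∑ k : Fin n, (k.rev : ℕ)) := by
  refine isHomogeneous_of_coeffAt fun m hm => ?_
  rw [alternant_eq, coeffAt_det_inVar, ← Matrix.det_transpose, Matrix.det_apply]
  refine Finset.sum_eq_zero fun σ _ => ?_
  suffices ∃ k, m k ≠ shifted n lam (σ k) by
    obtain ⟨k, hk⟩ := this
    rw [Finset.prod_eq_zero (Finset.mem_univ k), smul_zero]
    simp [PowerSeries.coeff_X_pow, hk]
  by_contra! hcon
  refine hm ?_
  rw [← sum_shifted hl, ← Equiv.sum_comp σ (shifted n lam)]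
  exact Finset.sum_congr rfl fun k _ => hcon k

theorem rename_alternant (lam : YoungDiagram) (σ : Equiv.Perm (Fin n)) :
    MvPowerSeries.rename σ (alternant R n lam) =
      ((Equiv.Perm.sign σ : ℤ) : R) • alternant R n lam := by
  rw [alternant, ← AlgHom.coe_toRingHom, RingHom.map_det]
  have h := Matrix.det_permute σ (Matrix.of fun k j : Fin n =>
    (MvPowerSeries.X k : MvPowerSeries (Fin n) R) ^ shifted n lam j)
  rw [MvPowerSeries.smul_eq_C_mul, map_intCast]
  refine Eq.trans ?_ h
  congr 1
  ext k j : 1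
  simp [RingHom.mapMatrix_apply]

theorem rename_schurSeries (lam : YoungDiagram) (σ : Equiv.Perm (Fin n)) :
    MvPowerSeries.rename σ (schurSeries R n lam) = schurSeries R n lam := by
  have h := map_jacobiTrudi (MvPowerSeries.rename (R := R) σ).toRingHom
    (seqOf (homGen R n)) lam
  refine h.trans ?_
  rw [schurSeries]
  congr 1
  funext m
  simp only [seqOf, homGen, PowerSeries.coeff_mk]
  split_ifs with hm
  · ext x
    rw [AlgHom.toRingHom_eq_coe, RingHom.coe_coe, coeff_eq_coeffAt, coeffAt_rename_perm,
      coeffAt, coeff_homOn, coeff_homOn, degree_equivFunOnFinite_symm, Finsupp.degree_eq_sum]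
    have : ∑ k, ((x : Fin n → ℕ) ∘ σ) k = ∑ k, x k := Equiv.sum_comp σ x
    rw [this]
    simp
  · simp

/-- The Vandermonde product of the variables. -/
noncomputable abbrev vdmX (R : Type*) [CommRing R] (n : ℕ) : MvPowerSeries (Fin n) R :=
  vdm (MvPowerSeries.X : Fin n → MvPowerSeries (Fin n) R)

theorem vdmX_ne_zero : vdmX ℤ n ≠ 0 := by
  intro h
  have hb : (⊥ : YoungDiagram).colLen 0 ≤ n := by rw [colLen_bot]; exact Nat.zero_le _
  have h1 := coeffAt_alternant (R := ℤ) hb hb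
  rw [alternant_bot, show vdm MvPowerSeries.X = (0 : MvPowerSeries (Fin n) ℤ) from h] at h1
  simp at h1

/-- The coefficient of `a_{λ+δ}` in `V s_κ s_μ`. -/
noncomputable def structureCoeff (R : Type*) [CommRing R] (n : ℕ) (ka mu lam : YoungDiagram) : R :=
  coeffAt (shifted n lam) (schurSeries R n ka * schurSeries R n mu * vdmX R n)

theorem schurSeries_mul_vdmX {mu : YoungDiagram} (hm : mu.colLen 0 ≤ n) (ka : YoungDiagram) :
    schurSeries R n ka * schurSeries R n mu * vdmX R n =
      schurSeries R n ka * alternant R n mu := by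
  rw [alternant_eq_vdm_mul hm]
  ring

open scoped Classical in
theorem coeffAt_sum_smul_schurSeries {s : Finset YoungDiagram} (hs : ∀ mu ∈ s, mu.colLen 0 ≤ n)
    (a : YoungDiagram → R) {lam : YoungDiagram} (hl : lam.colLen 0 ≤ n) :
    coeffAt (shifted n lam) ((∑ mu ∈ s, MvPowerSeries.C (a mu) * schurSeries R n mu) * vdmX R n) =
      if lam ∈ s then a lam else 0 := by
  rw [Finset.sum_mul, map_sum]
  have h : ∀ mu ∈ s, coeffAt (shifted n lam) (MvPowerSeries.C (a mu) * schurSeries R n mu * vdmX R n) =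
      if lam = mu then a mu else 0 := by
    intro mu hmu
    rw [mul_assoc, mul_comm (schurSeries R n mu), ← alternant_eq_vdm_mul (hs mu hmu),
      ← MvPowerSeries.smul_eq_C_mul, map_smul, coeffAt_alternant (hs mu hmu) hl, smul_eq_mul, mul_ite, mul_one, mul_zero]
  rw [Finset.sum_congr rfl h, Finset.sum_ite_eq]

theorem colLen_le_of_mem_partsLE {N : ℕ} (hN : N ≤ n) {lam : YoungDiagram}
    (h : lam ∈ partsLE N) : lam.colLen 0 ≤ n :=
  (colLen_zero_le_card lam).trans ((mem_partsLE.1 h).trans hN)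

theorem isHomogeneous_schurSeries_mul_vdmX {ka mu : YoungDiagram} (hm : mu.colLen 0 ≤ n) :
    (schurSeries ℤ n ka * schurSeries ℤ n mu * vdmX ℤ n).IsHomogeneous
      (ka.card + mu.card + ∑ k : Fin n, (k.rev : ℕ)) := by
  rw [schurSeries_mul_vdmX hm, add_assoc]
  exact MvPowerSeries.IsHomogeneous.mul (isHomogeneous_schurSeries ka)
    (isHomogeneous_alternant hm)

theorem structureCoeff_eq_zero {ka mu lam : YoungDiagram} (hm : mu.colLen 0 ≤ n)
    (hl : lam.colLen 0 ≤ n) (h : lam.card ≠ ka.card + mu.card) :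
    structureCoeff ℤ n ka mu lam = 0 := by
  refine coeffAt_eq_zero_of_isHomogeneous (isHomogeneous_schurSeries_mul_vdmX hm) ?_
  rw [sum_shifted hl]
  omega

/-- The alternating polynomial `V s_κ s_μ` is a combination of alternants; dividing by `V` expands
`s_κ s_μ` in Schur functions. -/
theorem schurSeries_mul_eq_sum {ka mu : YoungDiagram} (hn : ka.card + mu.card ≤ n) :
    schurSeries ℤ n ka * schurSeries ℤ n mu =
      ∑ lam ∈ partsLE (ka.card + mu.card),
        MvPowerSeries.C (structureCoeff ℤ n ka mu lam) * schurSeries ℤ n lam := by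
  have hm : mu.colLen 0 ≤ n := (colLen_zero_le_card mu).trans (by omega)
  have halt : IsAlternating (schurSeries ℤ n ka * schurSeries ℤ n mu * vdmX ℤ n) := by
    refine isAlternating_of_rename (fun a ha => by omega) fun σ => ?_
    rw [schurSeries_mul_vdmX hm, map_mul, rename_schurSeries, rename_alternant,
      MvPowerSeries.smul_eq_C_mul, MvPowerSeries.smul_eq_C_mul, mul_left_comm]
  refine mul_right_cancel₀ (b := vdmX ℤ n) vdmX_ne_zero ?_
  have hsum : (∑ lam ∈ partsLE (ka.card + mu.card),
        MvPowerSeries.C (structureCoeff ℤ n ka mu lam) * schurSeries ℤ n lam) * vdmX ℤ n =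
      ∑ lam ∈ partsLE (ka.card + mu.card),
        MvPowerSeries.C (structureCoeff ℤ n ka mu lam) * alternant ℤ n lam := by
    rw [Finset.sum_mul]
    refine Finset.sum_congr rfl fun lam hlam => ?_
    rw [alternant_eq_vdm_mul (colLen_le_of_mem_partsLE hn hlam), mul_assoc,
      mul_comm (vdmX ℤ n)]
  rw [hsum]
  ext m
  rw [coeff_eq_coeffAt, coeff_eq_coeffAt]
  rcases le_or_gt (∑ k, m k) (ka.card + mu.card + ∑ k : Fin n, (k.rev : ℕ)) with hle | hgt
  · exact halt.coeffAt_eq_sum_alternant hn m hle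
  · rw [coeffAt_eq_zero_of_isHomogeneous (isHomogeneous_schurSeries_mul_vdmX hm) hgt.ne', map_sum,
      Finset.sum_eq_zero]
    intro lam hlam
    rw [← MvPowerSeries.smul_eq_C_mul, map_smul, coeffAt_eq_zero_of_isHomogeneous
      (isHomogeneous_alternant (colLen_le_of_mem_partsLE hn hlam)), smul_zero]
    have := mem_partsLE.1 hlam
    omega

/-- The structure coefficients do not depend on the number of variables. -/
theorem structureCoeff_stable {ka mu lam : YoungDiagram} (hn : ka.card + mu.card ≤ n)
    (hl : lam ∈ partsLE (ka.card + mu.card)) :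
    structureCoeff ℤ n ka mu lam = structureCoeff ℤ (ka.card + mu.card) ka mu lam := by
  classical
  have h1 := congrArg (MvPowerSeries.killCompl (R := ℤ) (Fin.castLEEmb hn))
    (schurSeries_mul_eq_sum hn)
  simp only [map_mul, map_sum, MvPowerSeries.killCompl_C,
    killCompl_schurSeries] at h1
  have hlen : ∀ nu ∈ partsLE (ka.card + mu.card), nu.colLen 0 ≤ ka.card + mu.card :=
    fun nu h => colLen_le_of_mem_partsLE le_rfl h
  have h2 := coeffAt_sum_smul_schurSeries hlen (structureCoeff ℤ n ka mu) (hlen lam hl)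
  rw [if_pos hl, ← h1] at h2
  exact h2.symm

/-- The expansion of `s_κ s_μ` has the same coefficients in any number of variables, also when this
number is so small that the Schur functions in it are not linearly independent. -/
theorem schurSeries_mul_eq_sum' (n : ℕ) (ka mu : YoungDiagram) :
    schurSeries ℤ n ka * schurSeries ℤ n mu =
      ∑ lam ∈ partsLE (ka.card + mu.card),
        MvPowerSeries.C (structureCoeff ℤ (ka.card + mu.card) ka mu lam) * schurSeries ℤ n lam := by
  rcases le_total (ka.card + mu.card) n with hn | hn
  · rw [schurSeries_mul_eq_sum hn]
    exact Finset.sum_congr rfl fun lam hlam => by rw [structureCoeff_stable hn hlam]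
  · have h1 := congrArg (MvPowerSeries.killCompl (R := ℤ) (Fin.castLEEmb hn))
      (schurSeries_mul_eq_sum (le_refl (ka.card + mu.card)))
    simpa only [map_mul, map_sum, MvPowerSeries.killCompl_C,
    killCompl_schurSeries] using h1

theorem isSchurExpansion_iff (ka mu : YoungDiagram) (c : YoungDiagram →₀ ℤ) :
    IsSchurExpansion ka mu c ↔ ∀ n, schurSeries ℤ n ka * schurSeries ℤ n mu =
      ∑ lam ∈ c.support, MvPowerSeries.C (c lam) * schurSeries ℤ n lam := by
  refine forall_congr' fun n => ?_
  rw [← (MvPolynomial.coe_injective (Fin n) ℤ).eq_iff, MvPolynomial.coe_mul, coe_schurPoly,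
    coe_schurPoly, Finsupp.sum, ← MvPolynomial.coeToMvPowerSeries.ringHom_apply, map_sum]
  have h : ∀ lam, MvPolynomial.coeToMvPowerSeries.ringHom (c lam • schurPoly n lam) =
      MvPowerSeries.C (c lam) * schurSeries ℤ n lam := fun lam => by
    rw [zsmul_eq_mul, map_mul, map_intCast, MvPolynomial.coeToMvPowerSeries.ringHom_apply,
      coe_schurPoly, ← map_intCast (MvPowerSeries.C (σ := Fin n) (R := ℤ)), Int.cast_id]
  simp only [h]

theorem exists_isSchurExpansion (ka mu : YoungDiagram) : ∃ c, IsSchurExpansion ka mu c := by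
  classical
  refine ⟨Finsupp.onFinset (partsLE (ka.card + mu.card)) (fun lam =>
    if lam ∈ partsLE (ka.card + mu.card) then
      structureCoeff ℤ (ka.card + mu.card) ka mu lam else 0) (fun lam h => ?_), ?_⟩
  · by_contra hlam
    exact h (if_neg hlam)
  · rw [isSchurExpansion_iff]
    intro n
    rw [schurSeries_mul_eq_sum']
    symm
    refine Finset.sum_subset_zero_on_sdiff (Finsupp.support_onFinset_subset) ?_ ?_
    · intro lam hlam
      rw [Finset.mem_sdiff, Finsupp.notMem_support_iff] at hlam
      have h2 := hlam.2
      rw [Finsupp.onFinset_apply, if_pos hlam.1] at h2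
      rw [h2, map_zero, zero_mul]
    · intro lam hlam
      rw [Finsupp.onFinset_apply, if_pos (Finsupp.support_onFinset_subset hlam)]

theorem littlewoodRichardson_eq_structureCoeff_int {ka mu lam : YoungDiagram}
    (hn : ka.card + mu.card ≤ n) (hl : lam.colLen 0 ≤ n) :
    littlewoodRichardson lam ka mu = structureCoeff ℤ n ka mu lam := by
  classical
  have hc := exists_isSchurExpansion ka mu
  rw [littlewoodRichardson, dif_pos hc]
  have hspec := (isSchurExpansion_iff ka mu _).1 hc.choose_spec
  set c := hc.choose
  -- enough variables to see all diagrams of the expansion `c`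
  let M := max n (c.support.sup fun nu => nu.colLen 0)
  have hM : n ≤ M := le_max_left _ _
  have hlM : lam.colLen 0 ≤ M := hl.trans hM
  have h1 := coeffAt_sum_smul_schurSeries (R := ℤ) (n := M) (s := c.support)
    (fun nu hnu => (Finset.le_sup (f := fun nu : YoungDiagram => nu.colLen 0) hnu).trans
      (le_max_right _ _)) c hlM
  rw [← hspec M] at h1
  have h2 : c lam = structureCoeff ℤ M ka mu lam := by
    rw [structureCoeff, h1]
    split_ifs with h
    · rfl
    · exact Finsupp.notMem_support_iff.1 h
  rw [h2]
  have hm : mu.colLen 0 ≤ n := (colLen_zero_le_card mu).trans (by omega)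
  by_cases hcard : lam.card = ka.card + mu.card
  · have hmem := mem_partsLE.2 hcard.le
    rw [structureCoeff_stable (hn.trans hM) hmem, structureCoeff_stable hn hmem]
  · rw [structureCoeff_eq_zero (hm.trans hM) hlM hcard, structureCoeff_eq_zero hm hl hcard]

theorem card_eq_of_littlewoodRichardson_ne_zero {ka mu lam : YoungDiagram}
    (h : littlewoodRichardson lam ka mu ≠ 0) : lam.card = ka.card + mu.card := by
  by_contra hne
  have hm : mu.colLen 0 ≤ ka.card + mu.card + lam.card :=
    (colLen_zero_le_card mu).trans (by omega)
  have hl : lam.colLen 0 ≤ ka.card + mu.card + lam.card :=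
    (colLen_zero_le_card lam).trans (by omega)
  rw [littlewoodRichardson_eq_structureCoeff_int (by omega) hl] at h
  exact h (structureCoeff_eq_zero hm hl hne)

theorem map_vdmX {S : Type*} [CommRing S] (φ : R →+* S) :
    MvPowerSeries.map φ (vdmX R n) = vdmX S n := by
  rw [vdmX, vdm, RingHom.map_det, vdmX, vdm]
  congr 1
  ext k j : 1
  simp

/-- Littlewood-Richardson coefficients are the structure coefficients, in sufficiently many
variables and over any ring. -/
theorem littlewoodRichardson_eq_structureCoeff {ka mu lam : YoungDiagram}
    (hn : ka.card + mu.card ≤ n) (hl : lam.colLen 0 ≤ n) :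
    (littlewoodRichardson lam ka mu : R) = structureCoeff R n ka mu lam := by
  rw [littlewoodRichardson_eq_structureCoeff_int hn hl, structureCoeff, structureCoeff,
    ← map_schurSeries (Int.castRingHom R), ← map_schurSeries (Int.castRingHom R),
    ← map_vdmX (Int.castRingHom R), ← map_mul, ← map_mul, coeffAt, coeffAt,
    MvPowerSeries.coeff_map]
  rfl

end LittlewoodRichardson

/-! ### Pair products and interpolation -/

section PairProducts

variable {A : Type*} [CommRing A] {n : ℕ}

/-- The product `∏_{i<j} (1 - t_i t_j)`. -/
def pairProd (t : Fin n → A) : A := ∏ i, ∏ j, if i < j then 1 - t i * t j else 1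

theorem pairProd_succAbove (t : Fin (n + 1) → A) (k : Fin (n + 1)) :
    pairProd t = pairProd (fun i => t (k.succAbove i)) *
      ∏ i, (1 - t (k.succAbove i) * t k) := by
  unfold pairProd
  rw [Fin.prod_univ_succAbove _ k, Fin.prod_univ_succAbove _ k, if_neg (lt_irrefl k), one_mul]
  simp only [Fin.prod_univ_succAbove _ k, Finset.prod_mul_distrib,
    (Fin.strictMono_succAbove k).lt_iff_lt]
  rw [← mul_assoc, ← Finset.prod_mul_distrib, mul_comm]
  congr 1
  refine Finset.prod_congr rfl fun i _ => ?_
  rcases lt_or_gt_of_ne (Fin.succAbove_ne k i) with h | h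
  · rw [if_neg h.le.not_gt, if_pos h, one_mul]
  · rw [if_pos h, if_neg h.le.not_gt, mul_one, mul_comm (t k)]

theorem pairProd_eq_prod_filter (t : Fin n → A) :
    pairProd t = ∏ p : Fin n × Fin n with p.1 < p.2, (1 - t p.1 * t p.2) := by
  rw [pairProd, Finset.prod_filter, ← Finset.univ_product_univ, Finset.prod_product]

theorem pairProd_comp_perm (t : Fin n → A) (σ : Equiv.Perm (Fin n)) :
    pairProd (fun i => t (σ i)) = pairProd t := by
  have key : ∀ τ : Equiv.Perm (Fin n), ∀ p : Fin n × Fin n, p.1 < p.2 →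
      ((if τ p.1 < τ p.2 then (τ p.1, τ p.2) else (τ p.2, τ p.1)) : Fin n × Fin n).1 <
      ((if τ p.1 < τ p.2 then (τ p.1, τ p.2) else (τ p.2, τ p.1)) : Fin n × Fin n).2 := by
    intro τ p hp
    split_ifs with h
    · exact h
    · exact lt_of_le_of_ne (not_lt.1 h) fun he => hp.ne (τ.injective he.symm)
  have inv : ∀ τ τ' : Equiv.Perm (Fin n), (∀ i, τ' (τ i) = i) → ∀ p : Fin n × Fin n, p.1 < p.2 →
      (fun q : Fin n × Fin n => if τ' q.1 < τ' q.2 then (τ' q.1, τ' q.2) else (τ' q.2, τ' q.1))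
        (if τ p.1 < τ p.2 then (τ p.1, τ p.2) else (τ p.2, τ p.1)) = p := by
    intro τ τ' hτ p hp
    split_ifs with h
    · simp only [hτ, if_pos hp]
    · simp only [hτ, if_neg hp.le.not_gt]
  rw [pairProd_eq_prod_filter, pairProd_eq_prod_filter]
  refine Finset.prod_nbij'
    (fun p => if σ p.1 < σ p.2 then (σ p.1, σ p.2) else (σ p.2, σ p.1))
    (fun p => if σ.symm p.1 < σ.symm p.2 then (σ.symm p.1, σ.symm p.2)
      else (σ.symm p.2, σ.symm p.1)) ?_ ?_ ?_ ?_ ?_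
  · intro p hp
    simp only [Finset.mem_filter, Finset.mem_univ, true_and] at hp ⊢
    exact key σ p hp
  · intro p hp
    simp only [Finset.mem_filter, Finset.mem_univ, true_and] at hp ⊢
    exact key σ.symm p hp
  · intro p hp
    simp only [Finset.mem_filter, Finset.mem_univ, true_and] at hp
    exact inv σ σ.symm σ.symm_apply_apply p hp
  · intro p hp
    simp only [Finset.mem_filter, Finset.mem_univ, true_and] at hp
    exact inv σ.symm σ σ.apply_symm_apply p hp
  · intro p _
    split_ifs
    · rfl
    · rw [mul_comm]

/-- Expanding along the last column a Vandermonde determinant in which this column has been replaced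
by the values of a polynomial of degree less than the size. -/
theorem sum_eval_mul_vdm_succAbove (t : Fin (n + 1) → A) (p : Polynomial A)
    (hp : p.natDegree ≤ n) :
    ∑ k : Fin (n + 1), (-1) ^ ((k : ℕ) + n) * p.eval (t k) *
      ((∏ i, t (k.succAbove i)) * vdm fun i => t (k.succAbove i)) = p.coeff 0 * vdm t := by
  have h1 := Matrix.det_updateCol_sum
    (Matrix.of fun k j : Fin (n + 1) => t k ^ (j.rev : ℕ)) (Fin.last n)
    (fun j => p.coeff (j.rev : ℕ))
  have h2 : (fun k : Fin (n + 1) => ∑ j : Fin (n + 1), p.coeff (j.rev : ℕ) •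
      (Matrix.of fun k j : Fin (n + 1) => t k ^ (j.rev : ℕ)) k j) = fun k => p.eval (t k) := by
    funext k
    rw [Polynomial.eval_eq_sum_range' (Nat.lt_succ_of_le hp), ← Fin.sum_univ_eq_sum_range
      (fun i => p.coeff i * t k ^ i), ← Equiv.sum_comp Fin.revPerm]
    simp only [Fin.revPerm_apply, Fin.rev_rev, Matrix.of_apply, smul_eq_mul]
  rw [h2, Fin.rev_last, Fin.val_zero, smul_eq_mul, Matrix.det_succ_column _ (Fin.last n)] at h1
  rw [vdm, ← h1]
  refine Finset.sum_congr rfl fun k _ => ?_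
  rw [Matrix.updateCol_self, Fin.val_last]
  congr 1
  rw [vdm, ← Matrix.det_mul_column]
  congr 1
  ext i j
  rw [Matrix.submatrix_apply, Fin.succAbove_last, Matrix.updateCol_ne (Fin.castSucc_lt_last j).ne]
  simp only [Matrix.of_apply]
  rw [← pow_succ', Fin.val_rev, Fin.val_rev]
  congr 1
  have := j.2
  simp only [Fin.val_castSucc]
  omega

end PairProducts

section Interpolation

variable {A : Type*} [CommRing A] {N : ℕ}

open Polynomial

/-- The polynomial `∏ (1 - t_i z)`. -/
noncomputable def recProd (t : Fin N → A) : A[X] := ∏ i, (1 - C (t i) * X)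

/-- The polynomial `∏ (z - t_i)`. -/
noncomputable def rootProd (t : Fin N → A) : A[X] := ∏ i, (X - C (t i))

theorem natDegree_recProd_le (t : Fin N → A) : (recProd t).natDegree ≤ N := by
  refine (natDegree_prod_le _ _).trans ((Finset.sum_le_card_nsmul _ _ 1 fun i _ => ?_).trans ?_)
  · refine (natDegree_sub_le _ _).trans ?_
    simp only [natDegree_one, zero_le, sup_of_le_right]
    exact (natDegree_C_mul_le _ _).trans natDegree_X_le
  · simp

theorem natDegree_rootProd_le (t : Fin N → A) : (rootProd t).natDegree ≤ N := by
  refine (natDegree_prod_le _ _).trans ((Finset.sum_le_card_nsmul _ _ 1 fun i _ => ?_).trans ?_)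
  · exact natDegree_X_sub_C_le _
  · simp

theorem coeff_zero_recProd (t : Fin N → A) : (recProd t).coeff 0 = 1 := by
  rw [recProd, coeff_zero_prod]
  simp

theorem coeff_zero_rootProd (t : Fin N → A) : (rootProd t).coeff 0 = (-1) ^ N * ∏ i, t i := by
  rw [rootProd, coeff_zero_prod]
  simp [Finset.prod_neg]

theorem coeff_recProd (t : Fin N → A) : (recProd t).coeff N = (-1) ^ N * ∏ i, t i := by
  have h := coeff_prod_of_natDegree_le (s := Finset.univ) (fun i => 1 - C (t i) * X) 1
    (fun p _ => by
      refine (natDegree_sub_le _ _).trans ?_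
      simp only [natDegree_one, zero_le, sup_of_le_right]
      exact (natDegree_C_mul_le _ _).trans natDegree_X_le)
  rw [Finset.card_univ, Fintype.card_fin, mul_one] at h
  rw [recProd, h]
  simp [coeff_one, Finset.prod_neg]

theorem coeff_rootProd (t : Fin N → A) : (rootProd t).coeff N = 1 := by
  have h := coeff_prod_of_natDegree_le (s := Finset.univ) (fun i => X - C (t i)) 1
    (fun p _ => natDegree_X_sub_C_le _)
  rw [Finset.card_univ, Fintype.card_fin, mul_one] at h
  rw [rootProd, h]
  simp

theorem eval_rootProd_self (t : Fin N → A) (k : Fin N) : (rootProd t).eval (t k) = 0 := by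
  rw [rootProd, eval_prod]
  exact Finset.prod_eq_zero (Finset.mem_univ k) (by simp)

theorem eval_recProd (t : Fin N → A) (a : A) : (recProd t).eval a = ∏ i, (1 - t i * a) := by
  simp [recProd, eval_prod]

theorem eval_rootProd (t : Fin N → A) (a : A) : (rootProd t).eval a = ∏ i, (a - t i) := by
  simp [rootProd, eval_prod]

variable {n : ℕ}

theorem eval_recProd_self (t : Fin (n + 1) → A) (k : Fin (n + 1)) :
    (recProd t).eval (t k) = (1 - t k ^ 2) * ∏ i, (1 - t (k.succAbove i) * t k) := by
  rw [eval_recProd, Fin.prod_univ_succAbove _ k, sq]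

/-- With `P = ∏ (1 - t_i z)` and `Q = ∏ (z - t_i)`, the interpolating polynomial is `P - c Q`, where
the constant `c` cancels the top coefficient. -/
theorem exists_poly_evenRows (t : Fin (n + 1) → A) : ∃ p : A[X], p.natDegree ≤ n ∧
    p.coeff 0 = 1 - (∏ i, t i) ^ 2 ∧
    ∀ k, p.eval (t k) = (1 - t k ^ 2) * ∏ i, (1 - t (k.succAbove i) * t k) := by
  refine ⟨recProd t - C ((-1) ^ (n + 1) * ∏ i, t i) * rootProd t, ?_, ?_, fun k => ?_⟩
  · rw [natDegree_le_iff_coeff_eq_zero]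
    intro m hm
    rcases eq_or_lt_of_le (Nat.succ_le_of_lt hm) with rfl | hlt
    · rw [coeff_sub, coeff_C_mul, coeff_recProd, coeff_rootProd, mul_one, sub_self]
    · rw [coeff_sub, coeff_C_mul,
        coeff_eq_zero_of_natDegree_lt ((natDegree_recProd_le t).trans_lt hlt),
        coeff_eq_zero_of_natDegree_lt ((natDegree_rootProd_le t).trans_lt hlt), mul_zero, sub_zero]
  · rw [coeff_sub, coeff_C_mul, coeff_zero_recProd, coeff_zero_rootProd]
    have h : ((-1 : A) ^ (n + 1)) ^ 2 = 1 := by rw [← pow_mul, mul_comm, pow_mul]; simp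
    linear_combination (-(∏ i, t i) ^ 2) * h
  · rw [eval_sub, eval_mul, eval_rootProd_self, mul_zero, sub_zero, eval_recProd_self]

theorem natDegree_le_of_X_sub_C_mul {a : A} {q : A[X]} {d : ℕ}
    (h : ((X - C a) * q).natDegree ≤ d + 1) : q.natDegree ≤ d := by
  nontriviality A
  rcases eq_or_ne q 0 with rfl | hq
  · simp
  rw [(monic_X_sub_C a).natDegree_mul' hq, natDegree_X_sub_C] at h
  omega

/-- With `P = ∏ (1 - t_i z)` and `Q = ∏ (z - t_i)`, the interpolating polynomial is
`(P - (-ξ)^N Q) / (1 + ξ z)`, where `N = n + 1` is the number of variables. -/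
theorem exists_poly_all (t : Fin (n + 1) → A) {ξ : A} (hξ : ξ ^ 2 = 1)
    (hu : ∀ k, IsUnit (1 + ξ * t k)) : ∃ p : A[X], p.natDegree ≤ n ∧
    p.coeff 0 = 1 - ξ ^ (n + 1) * ∏ i, t i ∧
    ∀ k, p.eval (t k) = (1 - ξ * t k) * ∏ i, (1 - t (k.succAbove i) * t k) := by
  -- the numerator is chosen to vanish at `-ξ`
  have hroot : (recProd t - C ((-ξ) ^ (n + 1)) * rootProd t).IsRoot (-ξ) := by
    have h1 : ∏ i, (-ξ - t i) = (-ξ) ^ (n + 1) * ∏ i, (1 - t i * (-ξ)) := by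
      have : ∀ i, -ξ - t i = -ξ * (1 - t i * (-ξ)) := fun i => by
        linear_combination (t i) * hξ
      simp only [this, Finset.prod_mul_distrib, Finset.prod_const, Finset.card_univ,
        Fintype.card_fin]
    have h2 : (-ξ) ^ (n + 1) * (-ξ) ^ (n + 1) = 1 := by
      rw [← mul_pow, neg_mul_neg, ← sq, hξ, one_pow]
    rw [IsRoot.def, eval_sub, eval_mul, eval_C, eval_recProd, eval_rootProd, h1, ← mul_assoc, h2,
      one_mul, sub_self]
  obtain ⟨q, hq⟩ := dvd_iff_isRoot.2 hroot
  refine ⟨C ξ * q, ?_, ?_, fun k => ?_⟩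
  · refine (natDegree_C_mul_le _ _).trans (natDegree_le_of_X_sub_C_mul (a := -ξ) ?_)
    rw [← hq]
    exact (natDegree_sub_le _ _).trans (max_le (natDegree_recProd_le t)
      ((natDegree_C_mul_le _ _).trans (natDegree_rootProd_le t)))
  · have h0 := congrArg (fun f => coeff f 0) hq
    simp only [coeff_sub, coeff_zero_recProd, coeff_zero_rootProd, mul_coeff_zero, coeff_X_zero, coeff_C_zero, zero_sub, neg_neg] at h0
    rw [coeff_C_mul, ← h0, neg_pow]
    have h : ((-1 : A) ^ (n + 1)) ^ 2 = 1 := by rw [← pow_mul, mul_comm, pow_mul]; simp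
    linear_combination (-(∏ i, t i) * ξ ^ (n + 1)) * h
  · have h1 := congrArg (fun f => eval (t k) f) hq
    simp only [eval_sub, eval_mul, eval_rootProd_self, mul_zero, sub_zero, eval_recProd_self,
      eval_X, eval_C] at h1
    rw [eval_mul, eval_C]
    refine (hu k).mul_left_cancel ?_
    linear_combination (-1 : A) * h1 + (q.eval (t k) * t k
      + t k ^ 2 * ∏ i, (1 - t (k.succAbove i) * t k)) * hξ

/-- With `P = ∏ (1 - t_i z)` and `Q = ∏ (z - t_i)`, the interpolating polynomial is
`(P - Q) / (1 - z²)` or `(P - z Q) / (1 - z²)`, according to the parity of the number of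
variables. -/
theorem exists_poly_evenCols (h2 : IsUnit (2 : A)) (t : Fin (n + 1) → A)
    (hu : ∀ k, IsUnit (1 - t k ^ 2)) : ∃ p : A[X], p.natDegree ≤ n ∧
    p.coeff 0 = 1 - (if Even (n + 1) then ∏ i, t i else 0) ∧
    ∀ k, p.eval (t k) = ∏ i, (1 - t (k.succAbove i) * t k) := by
  -- the numerator is chosen to vanish at `1` and `-1`
  obtain ⟨f, hdeg, hf0, hft, hf1, hf2⟩ : ∃ f : A[X], f.natDegree ≤ n + 1 + 1 ∧
      f.coeff 0 = 1 - (if Even (n + 1) then ∏ i, t i else 0) ∧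
      (∀ k, f.eval (t k) = (1 - t k ^ 2) * ∏ i, (1 - t (k.succAbove i) * t k)) ∧
      f.eval 1 = 0 ∧ f.eval (-1) = 0 := by
    have h1 : ∏ i, (-1 - t i) = (-1) ^ (n + 1) * ∏ i, (1 - t i * (-1)) := by
      have : ∀ i, -1 - t i = -1 * (1 - t i * (-1)) := fun i => by ring
      simp only [this, Finset.prod_mul_distrib, Finset.prod_const, Finset.card_univ,
        Fintype.card_fin]
    by_cases hn : Even (n + 1)
    · refine ⟨recProd t - rootProd t, ?_, ?_, fun k => ?_, ?_, ?_⟩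
      · exact (natDegree_sub_le _ _).trans (max_le ((natDegree_recProd_le t).trans (by omega))
          ((natDegree_rootProd_le t).trans (by omega)))
      · rw [coeff_sub, coeff_zero_recProd, coeff_zero_rootProd, if_pos hn, hn.neg_one_pow, one_mul]
      · rw [eval_sub, eval_rootProd_self, eval_recProd_self, sub_zero]
      · simp [eval_recProd, eval_rootProd]
      · rw [eval_sub, eval_recProd, eval_rootProd, h1, hn.neg_one_pow, one_mul, sub_self]
    · refine ⟨recProd t - X * rootProd t, ?_, ?_, fun k => ?_, ?_, ?_⟩
      · exact (natDegree_sub_le _ _).trans (max_le ((natDegree_recProd_le t).trans (by omega))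
          (natDegree_mul_le.trans ((add_le_add natDegree_X_le (natDegree_rootProd_le t)).trans
            (by omega))))
      · rw [coeff_sub, coeff_zero_recProd, mul_coeff_zero, coeff_X_zero, if_neg hn, zero_mul]
      · rw [eval_sub, eval_mul, eval_rootProd_self, eval_recProd_self, mul_zero, sub_zero]
      · simp [eval_recProd, eval_rootProd]
      · rw [eval_sub, eval_mul, eval_X, eval_recProd, eval_rootProd, h1,
          (Nat.not_even_iff_odd.1 hn).neg_one_pow]
        ring
  obtain ⟨q, rfl⟩ := dvd_iff_isRoot.2 (show f.IsRoot 1 from hf1)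
  have hq : q.IsRoot (-1) := by
    rw [eval_mul, eval_sub, eval_X, eval_C] at hf2
    rw [IsRoot.def]
    refine h2.mul_left_cancel ?_
    linear_combination (-1 : A) * hf2
  obtain ⟨r, rfl⟩ := dvd_iff_isRoot.2 hq
  refine ⟨-r, ?_, ?_, fun k => ?_⟩
  · rw [natDegree_neg]
    exact natDegree_le_of_X_sub_C_mul (natDegree_le_of_X_sub_C_mul hdeg)
  · rw [← hf0]
    simp [mul_coeff_zero]
  · refine (hu k).mul_left_cancel ?_
    rw [← hft k]
    simp only [eval_mul, eval_sub, eval_X, eval_C, eval_neg]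
    ring

end Interpolation

/-! ### The recursion on the number of variables -/

section Littlewood

variable {R : Type*} [CommRing R] {n : ℕ}

open MvPowerSeries (X)

/-- The product `∏_{i<j} (1 - t_i t_j) ∏_k φ(t_k)`, the inverse of a Littlewood series. -/
noncomputable def littlewoodDenom (n : ℕ) (φ : PowerSeries R) : MvPowerSeries (Fin n) R :=
  pairProd X * ∏ k, inVar k φ

theorem constantCoeff_inVar (k : Fin n) (φ : PowerSeries R) :
    MvPowerSeries.constantCoeff (inVar k φ) = PowerSeries.constantCoeff φ :=
  MvPowerSeries.constantCoeff_rename _ _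

theorem rename_inVar {n' : ℕ} (e : Fin n → Fin n') (k : Fin n) (φ : PowerSeries R) :
    MvPowerSeries.rename e (inVar k φ) = inVar (e k) φ := by
  rw [inVar, MvPowerSeries.rename_rename]
  rfl

theorem isUnit_littlewoodDenom {φ : PowerSeries R} (hφ : PowerSeries.constantCoeff φ = 1) :
    IsUnit (littlewoodDenom n φ) := by
  rw [MvPowerSeries.isUnit_iff_constantCoeff, littlewoodDenom, map_mul, map_prod, pairProd,
    map_prod]
  simp only [constantCoeff_inVar, hφ, Finset.prod_const_one, mul_one, map_prod]
  convert isUnit_one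
  refine Finset.prod_eq_one fun i _ => Finset.prod_eq_one fun j _ => ?_
  split_ifs <;> simp

theorem map_pairProd {A B : Type*} [CommRing A] [CommRing B] (ψ : A →+* B) (t : Fin n → A) :
    ψ (pairProd t) = pairProd fun i => ψ (t i) := by
  rw [pairProd, pairProd, map_prod]
  refine Finset.prod_congr rfl fun i _ => ?_
  rw [map_prod]
  refine Finset.prod_congr rfl fun j _ => ?_
  split_ifs <;> simp

theorem map_vdm {A B : Type*} [CommRing A] [CommRing B] (ψ : A →+* B) (t : Fin n → A) :
    ψ (vdm t) = vdm fun i => ψ (t i) := by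
  rw [vdm, vdm, RingHom.map_det]
  congr 1
  ext i j : 1
  simp

theorem rename_littlewoodDenom (φ : PowerSeries R) (σ : Equiv.Perm (Fin n)) :
    MvPowerSeries.rename σ (littlewoodDenom n φ) = littlewoodDenom n φ := by
  have h1 := map_pairProd (MvPowerSeries.rename (R := R) σ).toRingHom X
  simp only [AlgHom.toRingHom_eq_coe, RingHom.coe_coe, MvPowerSeries.rename_X] at h1
  rw [littlewoodDenom, map_mul, h1, pairProd_comp_perm X σ, map_prod]
  simp only [rename_inVar]
  rw [Equiv.prod_comp σ (fun k => inVar k φ)]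

theorem littlewoodDenom_succ (φ : PowerSeries R) (k : Fin (n + 1)) :
    littlewoodDenom (n + 1) φ = MvPowerSeries.rename k.succAbove (littlewoodDenom n φ) *
      (inVar k φ * ∏ i, (1 - X (k.succAbove i) * X k)) := by
  have h1 := map_pairProd (MvPowerSeries.rename (R := R) k.succAbove).toRingHom X
  simp only [AlgHom.toRingHom_eq_coe, RingHom.coe_coe, MvPowerSeries.rename_X] at h1
  rw [littlewoodDenom, littlewoodDenom, map_mul, h1, map_prod, pairProd_succAbove X k,
    Fin.prod_univ_succAbove _ k]
  simp only [rename_inVar]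
  ring

/-- The quotient of the Vandermonde product by a symmetric product is alternating. -/
theorem isAlternating_of_mul_littlewoodDenom (h2 : ∀ a : R, 2 * a = 0 → a = 0)
    {φ : PowerSeries R} (hφ : PowerSeries.constantCoeff φ = 1) {f : MvPowerSeries (Fin n) R}
    (hf : f * littlewoodDenom n φ = vdmX R n) : IsAlternating f := by
  refine isAlternating_of_rename h2 fun σ => ?_
  have h1 := congrArg (MvPowerSeries.rename (R := R) σ) hf
  have h3 := rename_alternant (R := R) (n := n) ⊥ σ
  rw [alternant_bot] at h3
  rw [map_mul, rename_littlewoodDenom, h3] at h1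
  refine (isUnit_littlewoodDenom hφ).mul_right_cancel ?_
  rw [h1, smul_mul_assoc, hf]

/-- The recursion on the number of variables behind the Littlewood identities. -/
theorem littlewood_recursion {φ : PowerSeries R} (hφ : PowerSeries.constantCoeff φ = 1)
    {f : MvPowerSeries (Fin (n + 1)) R} {f' : MvPowerSeries (Fin n) R}
    (hf : f * littlewoodDenom (n + 1) φ = vdmX R (n + 1))
    (hf' : f' * littlewoodDenom n φ = vdmX R n)
    {p : Polynomial (MvPowerSeries (Fin (n + 1)) R)} (hdeg : p.natDegree ≤ n)
    (hp : ∀ k, p.eval (X k) = inVar k φ * ∏ i, (1 - X (k.succAbove i) * X k)) :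
    p.coeff 0 * f = ∑ k : Fin (n + 1), (-1) ^ ((k : ℕ) + n) *
      MvPowerSeries.rename k.succAbove ((∏ i, X i) * f') := by
  refine (isUnit_littlewoodDenom hφ).mul_right_cancel ?_
  rw [mul_assoc, hf, vdmX, ← sum_eval_mul_vdm_succAbove _ p hdeg, Finset.sum_mul]
  refine Finset.sum_congr rfl fun k _ => ?_
  have h1 := map_vdm (MvPowerSeries.rename (R := R) k.succAbove).toRingHom X
  simp only [AlgHom.toRingHom_eq_coe, RingHom.coe_coe, MvPowerSeries.rename_X] at h1
  rw [hp, littlewoodDenom_succ φ k, ← h1, ← vdmX, ← hf', map_mul, map_mul, map_prod]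
  simp only [MvPowerSeries.rename_X]
  ring

theorem coeffAt_rename_succAbove (k : Fin (n + 1)) (f : MvPowerSeries (Fin n) R)
    (m : Fin (n + 1) → ℕ) : coeffAt m (MvPowerSeries.rename k.succAbove f) =
      if m k = 0 then coeffAt (fun i => m (k.succAbove i)) f else 0 := by
  split_ifs with hm
  · have h := MvPowerSeries.coeff_embDomain_rename (k.succAboveEmb) f
      (Finsupp.equivFunOnFinite.symm fun i => m (k.succAbove i))
    rw [coeffAt, coeffAt, ← h]
    have he : Finsupp.equivFunOnFinite.symm m = Finsupp.embDomain k.succAboveEmb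
        (Finsupp.equivFunOnFinite.symm fun i => m (k.succAbove i)) := by
      ext i
      rcases Fin.eq_self_or_eq_succAbove k i with rfl | ⟨j, rfl⟩
      · rw [Finsupp.embDomain_of_notMem_range _ _ _ (by simp)]
        exact hm
      · exact (Finsupp.embDomain_apply_self k.succAboveEmb (Finsupp.equivFunOnFinite.symm
          fun i => m (k.succAbove i)) j).symm
    rw [he]
    rfl
  · rw [coeffAt]
    refine MvPowerSeries.coeff_rename_eq_zero _ _ ?_
    rintro ⟨x, hx⟩
    refine hm ?_
    have h1 := DFunLike.congr_fun hx k
    rw [Finsupp.mapDomain_of_notMem_range _ _ (by simp)] at h1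
    exact h1.symm

theorem coeffAt_prod_X_mul (f : MvPowerSeries (Fin n) R) (m : Fin n → ℕ) :
    coeffAt m ((∏ i, X i) * f) =
      if ∀ i, m i ≠ 0 then coeffAt (fun i => m i - 1) f else 0 := by
  classical
  have hprod : (∏ i, X i : MvPowerSeries (Fin n) R) =
      MvPowerSeries.monomial (Finsupp.equivFunOnFinite.symm fun _ => 1) 1 := by
    change ∏ i, MvPowerSeries.monomial (Finsupp.single i 1) (1 : R) = _
    have hsum : ∑ i : Fin n, Finsupp.single i 1 =
        Finsupp.equivFunOnFinite.symm fun _ : Fin n => 1 := by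
      ext i
      simp [Finsupp.coe_finsetSum, Finsupp.single_apply]
    rw [MvPowerSeries.prod_monomial, Finset.prod_const_one, hsum]
  rw [hprod, coeffAt, MvPowerSeries.coeff_monomial_mul]
  have hiff : (Finsupp.equivFunOnFinite.symm fun _ : Fin n => 1) ≤ Finsupp.equivFunOnFinite.symm m ↔
      ∀ i, m i ≠ 0 := by
    refine forall_congr' fun i => ?_
    rw [Finsupp.equivFunOnFinite_symm_apply_apply, Finsupp.equivFunOnFinite_symm_apply_apply,
      Nat.one_le_iff_ne_zero]
  simp only [hiff, one_mul]
  split_ifs with h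
  · rw [coeffAt]
    congr 2
    ext i
    simp
  · rfl

/-- The exponent vector `a + δ`. -/
def addStair (a : Fin n → ℕ) (i : Fin n) : ℕ := a i + (i.rev : ℕ)

theorem addStair_ne_zero {a : Fin (n + 1) → ℕ} (h : a (Fin.last n) ≠ 0) (i : Fin (n + 1)) :
    addStair a i ≠ 0 := by
  unfold addStair
  rcases eq_or_ne i (Fin.last n) with rfl | hi
  · omega
  · have h1 : (i : ℕ) ≠ n := fun h => hi (Fin.ext h)
    have := i.2
    rw [Fin.val_rev]
    omega

theorem coeffAt_prod_X_mul_addStair (f : MvPowerSeries (Fin (n + 1)) R) {a : Fin (n + 1) → ℕ}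
    (ha : Antitone a) : coeffAt (addStair a) ((∏ i, X i) * f) =
      if a (Fin.last n) = 0 then 0 else coeffAt (addStair fun i => a i - 1) f := by
  rw [coeffAt_prod_X_mul]
  split_ifs with h1 h2 h2
  · exact absurd (by simp [addStair, h2]) (h1 (Fin.last n))
  · congr 1
    refine congrArg _ (funext fun i => ?_)
    have := ha (Fin.le_last i)
    change a i + (i.rev : ℕ) - 1 = a i - 1 + (i.rev : ℕ)
    omega
  · rfl
  · exact absurd (addStair_ne_zero h2) h1

/-- Extracting the coefficient at `a + δ` from the right-hand side of `littlewood_recursion`: only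
the last summand contributes, and only when `a` ends with `0`. -/
theorem coeffAt_sum_rename (f' : MvPowerSeries (Fin n) R) {a : Fin (n + 1) → ℕ} :
    coeffAt (addStair a) (∑ k : Fin (n + 1), (-1) ^ ((k : ℕ) + n) *
      MvPowerSeries.rename k.succAbove ((∏ i, X i) * f')) =
      if a (Fin.last n) = 0 then coeffAt (addStair fun i => a i.castSucc) f' else 0 := by
  have hsign : ∀ (d : ℕ) (g : MvPowerSeries (Fin (n + 1)) R) (m : Fin (n + 1) → ℕ),
      coeffAt m ((-1) ^ d * g) = (-1) ^ d * coeffAt m g := by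
    intro d g m
    rw [← map_one (MvPowerSeries.C (σ := Fin (n + 1)) (R := R)), ← map_neg, ← map_pow,
      ← MvPowerSeries.smul_eq_C_mul, map_smul, smul_eq_mul]
  simp only [map_sum, hsign, coeffAt_rename_succAbove]
  split_ifs with h
  · rw [Finset.sum_eq_single (Fin.last n)]
    · rw [if_pos (by simp [addStair, h]), Fin.val_last, Even.neg_one_pow ⟨n, rfl⟩, one_mul,
        coeffAt_prod_X_mul, if_pos]
      · refine congrArg (fun m => coeffAt m f') (funext fun i => ?_)
        simp only [addStair, Fin.succAbove_last, Fin.val_rev, Fin.val_castSucc]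
        have := i.2
        omega
      · intro i
        simp only [addStair, Fin.succAbove_last, Fin.val_rev, Fin.val_castSucc]
        have := i.2
        omega
    · intro k _ hk
      rw [coeffAt_prod_X_mul, if_neg (c := ∀ i, _), ite_self, mul_zero]
      intro hne
      obtain ⟨i, hi⟩ := Fin.exists_succAbove_eq hk.symm
      exact hne i (by simp [hi, addStair, h])
    · simp
  · refine Finset.sum_eq_zero fun k _ => ?_
    rw [if_neg (addStair_ne_zero h k), mul_zero]

theorem exists_mul_littlewoodDenom {φ : PowerSeries R} (hφ : PowerSeries.constantCoeff φ = 1) :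
    ∃ f, f * littlewoodDenom n φ = vdmX R n := by
  obtain ⟨u, hu⟩ := isUnit_littlewoodDenom (n := n) hφ
  exact ⟨vdmX R n * (↑u⁻¹ : MvPowerSeries (Fin n) R), by rw [← hu, mul_assoc, u.inv_mul, mul_one]⟩

/-- The coefficients at `a + δ` of the quotient of `V` by `littlewoodDenom n φ` are the values `χ n a`,
provided `χ` satisfies the recursions that `littlewood_recursion` imposes on them: one removing a
last entry `0` of `a`, and one expressing the case of a non-zero last entry through the smaller
vectors that the factor `w n` leads to. -/
theorem coeffAt_addStair_eq {φ : PowerSeries R} (hφ : PowerSeries.constantCoeff φ = 1)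
    (w : ∀ n, MvPowerSeries (Fin (n + 1)) R)
    (hpoly : ∀ n, ∃ p : Polynomial (MvPowerSeries (Fin (n + 1)) R), p.natDegree ≤ n ∧
      p.coeff 0 = 1 - w n ∧
      ∀ k, p.eval (X k) = inVar k φ * ∏ i, (1 - X (k.succAbove i) * X k))
    (χ : ∀ n, (Fin n → ℕ) → R) (hχ0 : ∀ a, χ 0 a = 1)
    (hzero : ∀ n (a : Fin (n + 1) → ℕ), Antitone a → a (Fin.last n) = 0 →
      χ (n + 1) a = χ n fun i => a i.castSucc)
    (hw0 : ∀ n (a : Fin (n + 1) → ℕ) (f : MvPowerSeries (Fin (n + 1)) R), Antitone a →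
      a (Fin.last n) = 0 → coeffAt (addStair a) (w n * f) = 0)
    (hw : ∀ n (a : Fin (n + 1) → ℕ) (f : MvPowerSeries (Fin (n + 1)) R), Antitone a →
      a (Fin.last n) ≠ 0 → (∀ b : Fin (n + 1) → ℕ, Antitone b → b (Fin.last n) < a (Fin.last n) →
        coeffAt (addStair b) f = χ (n + 1) b) →
      coeffAt (addStair a) (w n * f) = χ (n + 1) a)
    (f : MvPowerSeries (Fin n) R) (hf : f * littlewoodDenom n φ = vdmX R n) (a : Fin n → ℕ)
    (ha : Antitone a) : coeffAt (addStair a) f = χ n a := by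
  induction n with
  | zero =>
    have h1 : f = 1 := by
      simpa [littlewoodDenom, pairProd, vdmX, vdm] using hf
    rw [hχ0, h1, coeffAt]
    have : Finsupp.equivFunOnFinite.symm (addStair a) = 0 := by
      ext i
      exact i.elim0
    rw [this]
    simp
  | succ n ih =>
    obtain ⟨f', hf'⟩ := exists_mul_littlewoodDenom (n := n) hφ
    obtain ⟨p, hdeg, hp0, hp⟩ := hpoly n
    have hrec := littlewood_recursion hφ hf hf' hdeg hp
    rw [hp0, sub_mul, one_mul] at hrec
    induction hd : a (Fin.last n) using Nat.strong_induction_on generalizing a with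
    | _ d ihd =>
      have h1 := congrArg (coeffAt (addStair a)) hrec
      rw [map_sub, coeffAt_sum_rename] at h1
      by_cases h0 : a (Fin.last n) = 0
      · rw [hw0 n a f ha h0, if_pos h0, sub_zero] at h1
        rw [h1, hzero n a ha h0]
        exact ih f' hf' _ fun i j h => ha (Fin.castSucc_le_castSucc_iff.2 h)
      · rw [if_neg h0, hw n a f ha h0 fun b hb hlt => ihd _ (hd ▸ hlt) b hb rfl] at h1
        exact sub_eq_zero.1 h1

end Littlewood

/-! ### The three Littlewood identities -/

section Littlewood

variable {R : Type*} [CommRing R] {n : ℕ}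

open MvPowerSeries (X)

theorem inVar_C (k : Fin n) (a : R) : inVar k (PowerSeries.C a) = MvPowerSeries.C a :=
  MvPowerSeries.rename_C _ _

theorem isUnit_of_constantCoeff_eq_one {f : MvPowerSeries (Fin n) R}
    (h : MvPowerSeries.constantCoeff f = 1) : IsUnit f :=
  MvPowerSeries.isUnit_iff_constantCoeff.2 (h ▸ isUnit_one)

theorem rowLen_antitone (lam : YoungDiagram) : Antitone fun i : Fin n => lam.rowLen i :=
  fun i j h => lam.rowLen_anti i j (by exact_mod_cast h)

open scoped Classical in
/-- `∏_{i≤j} (1 - t_i t_j)⁻¹` is the sum of the Schur functions of partitions with even parts. -/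
theorem coeffAt_littlewood_evenRows {f : MvPowerSeries (Fin n) R}
    (hf : f * littlewoodDenom n (1 - PowerSeries.X ^ 2) = vdmX R n) {ka : YoungDiagram}
    (hka : ka.colLen 0 ≤ n) :
    coeffAt (shifted n ka) f = if ka ∈ evenRows then 1 else 0 := by
  have h := coeffAt_addStair_eq (φ := (1 - PowerSeries.X ^ 2 : PowerSeries R)) (by simp)
    (fun n => (∏ i, X i) ^ 2) (fun n => by
      obtain ⟨p, h1, h2, h3⟩ := exists_poly_evenRows
        (X : Fin (n + 1) → MvPowerSeries (Fin (n + 1)) R)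
      exact ⟨p, h1, h2, fun k => by rw [h3 k, map_sub, map_one, map_pow, inVar_X]⟩)
    (fun n a => if ∀ i, Even (a i) then 1 else 0) (fun a => if_pos fun i => i.elim0)
    (fun n a _ h0 => by simp [Fin.forall_fin_succ', h0])
    (fun n a f ha h0 => by rw [sq, mul_assoc, coeffAt_prod_X_mul_addStair _ ha, if_pos h0])
    (fun n a f ha h0 ih => by
      have ha1 : Antitone fun i => a i - 1 := fun i j h => Nat.sub_le_sub_right (ha h) 1
      rw [sq, mul_assoc, coeffAt_prod_X_mul_addStair _ ha, if_neg h0,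
        coeffAt_prod_X_mul_addStair _ ha1]
      have hge : ∀ i, a (Fin.last n) ≤ a i := fun i => ha (Fin.le_last i)
      by_cases h1 : a (Fin.last n) - 1 = 0
      · rw [if_pos h1, if_neg]
        intro hev
        have := hev (Fin.last n)
        rw [show a (Fin.last n) = 1 by omega] at this
        exact absurd this (by decide)
      · rw [if_neg h1, ih _ (fun i j h => Nat.sub_le_sub_right (ha1 h) 1)
          (by change a (Fin.last n) - 1 - 1 < a (Fin.last n); omega)]
        congr 1
        rw [eq_iff_iff]
        refine forall_congr' fun i => ?_
        have := hge i
        rw [Nat.sub_sub, Nat.even_sub (by omega)]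
        simp)
    f hf (fun i => ka.rowLen i) (rowLen_antitone ka)
  refine Eq.trans h ?_
  congr 1
  rw [eq_iff_iff]
  refine ⟨fun h i => ?_, fun h i => h i⟩
  rcases lt_or_ge i n with hi | hi
  · exact h ⟨i, hi⟩
  · rw [rowLen_eq_zero_of_colLen_le (hka.trans hi)]
    exact Even.zero

theorem colLen_eq_card_filter {lam : YoungDiagram} (hl : lam.colLen 0 ≤ n) (j : ℕ) :
    lam.colLen j = (Finset.univ.filter fun i : Fin n => j < lam.rowLen i).card := by
  have h1 : lam.colLen j ≤ n := (lam.colLen_anti 0 j (Nat.zero_le j)).trans hl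
  have h2 : ∀ i : Fin n, j < lam.rowLen i ↔ (i : ℕ) < lam.colLen j := fun i => by
    rw [← YoungDiagram.mem_iff_lt_rowLen, YoungDiagram.mem_iff_lt_colLen]
  simp only [h2]
  rw [Fin.card_filter_val_lt, min_eq_right h1]

open scoped Classical in
/-- `∏_{i<j} (1 - t_i t_j)⁻¹` is the sum of the Schur functions of partitions whose conjugate has
even parts. -/
theorem coeffAt_littlewood_evenCols (h2 : IsUnit (2 : R)) {f : MvPowerSeries (Fin n) R}
    (hf : f * littlewoodDenom n 1 = vdmX R n) {ka : YoungDiagram} (hka : ka.colLen 0 ≤ n) :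
    coeffAt (shifted n ka) f = if ka ∈ evenCols then 1 else 0 := by
  have h := coeffAt_addStair_eq (φ := (1 : PowerSeries R)) (by simp)
    (fun n => if Even (n + 1) then ∏ i, X i else 0) (fun n => by
      have h2' : IsUnit (2 : MvPowerSeries (Fin (n + 1)) R) := by
        have := h2.map (MvPowerSeries.C (σ := Fin (n + 1)) (R := R))
        rwa [map_ofNat] at this
      obtain ⟨p, h1, h2, h3⟩ := exists_poly_evenCols h2'
        (X : Fin (n + 1) → MvPowerSeries (Fin (n + 1)) R)
        (fun k => isUnit_of_constantCoeff_eq_one (by simp))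
      exact ⟨p, h1, h2, fun k => by rw [h3 k, map_one, one_mul]⟩)
    (fun n a => if ∀ j, Even (Finset.univ.filter fun i => j < a i).card then 1 else 0)
    (fun a => if_pos fun i => by simp)
    (fun n a _ h0 => by
      have : ∀ j, (Finset.univ.filter fun i => j < a i).card =
          (Finset.univ.filter fun i : Fin n => j < a i.castSucc).card := fun j => by
        rw [Finset.card_filter, Finset.card_filter, Fin.sum_univ_castSucc, h0,
          if_neg (Nat.not_lt_zero j), add_zero]
      simp only [this])
    (fun n a f ha h0 => by
      split_ifs
      · rw [coeffAt_prod_X_mul_addStair _ ha, if_pos h0]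
      · rw [zero_mul, map_zero])
    (fun n a f ha h0 ih => by
      have hcard : (Finset.univ.filter fun i => 0 < a i).card = n + 1 := by
        rw [Finset.filter_true_of_mem fun i _ => ?_, Finset.card_univ, Fintype.card_fin]
        have := ha (Fin.le_last i)
        omega
      split_ifs with hn h1 h1
      · rw [coeffAt_prod_X_mul_addStair _ ha, if_neg h0,
          ih _ (fun i j h => Nat.sub_le_sub_right (ha h) 1) (by omega), if_pos]
        intro j
        simpa only [Nat.lt_sub_iff_add_lt] using h1 (j + 1)
      · rw [coeffAt_prod_X_mul_addStair _ ha, if_neg h0,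
          ih _ (fun i j h => Nat.sub_le_sub_right (ha h) 1) (by omega), if_neg]
        intro h
        refine h1 fun j => ?_
        rcases j with _ | j
        · rwa [hcard]
        · simpa only [Nat.lt_sub_iff_add_lt] using h j
      · exact absurd (hcard ▸ h1 0) hn
      · rw [zero_mul, map_zero])
    f hf (fun i => ka.rowLen i) (rowLen_antitone ka)
  refine Eq.trans h ?_
  simp only [← colLen_eq_card_filter hka]
  rfl

/-- `∏_i (1 - ξ t_i)⁻¹ ∏_{i<j} (1 - t_i t_j)⁻¹`, with `ξ² = 1`, is the sum of `ξ^|κ| s_κ` over all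
partitions `κ`. -/
theorem coeffAt_littlewood_all {ξ : R} (hξ : ξ ^ 2 = 1) {f : MvPowerSeries (Fin n) R}
    (hf : f * littlewoodDenom n (1 - PowerSeries.C ξ * PowerSeries.X) = vdmX R n)
    {ka : YoungDiagram} (hka : ka.colLen 0 ≤ n) :
    coeffAt (shifted n ka) f = ξ ^ ka.card := by
  have h := coeffAt_addStair_eq (φ := (1 - PowerSeries.C ξ * PowerSeries.X : PowerSeries R))
    (by simp) (fun n => MvPowerSeries.C ξ ^ (n + 1) * ∏ i, X i) (fun n => by
      obtain ⟨p, h1, h2, h3⟩ := exists_poly_all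
        (X : Fin (n + 1) → MvPowerSeries (Fin (n + 1)) R) (ξ := MvPowerSeries.C ξ)
        (by rw [← map_pow, hξ, map_one])
        (fun k => isUnit_of_constantCoeff_eq_one (by simp))
      exact ⟨p, h1, h2, fun k => by
        rw [h3 k, map_sub, map_one, map_mul, inVar_X, inVar_C]⟩)
    (fun n a => ξ ^ ∑ i, a i) (fun a => by simp)
    (fun n a _ h0 => by rw [Fin.sum_univ_castSucc, h0, add_zero])
    (fun n a f ha h0 => by
      rw [← map_pow, mul_assoc, ← MvPowerSeries.smul_eq_C_mul, map_smul,
        coeffAt_prod_X_mul_addStair _ ha, if_pos h0, smul_zero])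
    (fun n a f ha h0 ih => by
      rw [← map_pow, mul_assoc, ← MvPowerSeries.smul_eq_C_mul, map_smul,
        coeffAt_prod_X_mul_addStair _ ha, if_neg h0,
        ih _ (fun i j h => Nat.sub_le_sub_right (ha h) 1) (by omega), smul_eq_mul, ← pow_add]
      congr 1
      have : ∀ i, a i = (a i - 1) + 1 := fun i => by
        have := ha (Fin.le_last i)
        omega
      rw [Finset.sum_congr rfl fun i _ => this i, Finset.sum_add_distrib]
      simp [add_comm])
    f hf (fun i => ka.rowLen i) (rowLen_antitone ka)
  refine Eq.trans h ?_
  rw [card_eq_sum_rowLen hka]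

end Littlewood

/-! ### Weyl denominators -/

section WeylDenominator

variable {A : Type*} [CommRing A] {n : ℕ}

/-- The function `f` is a form of degree `j` in `1 + t ^ 2` and `t`, monic in `1 + t ^ 2`. -/
def IsMonicForm (j : ℕ) (f : A → A) : Prop :=
  ∃ c : ℕ → A, c j = 1 ∧ (∀ i, j < i → c i = 0) ∧
    ∀ t, f t = ∑ i ∈ Finset.range (j + 1), c i * ((1 + t ^ 2) ^ i * t ^ (j - i))

theorem isMonicForm_zero : IsMonicForm 0 fun _ : A => 1 :=
  ⟨fun i => if i = 0 then 1 else 0, rfl, fun i hi => if_neg hi.ne', fun t => by simp⟩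

theorem isMonicForm_one : IsMonicForm 1 fun t : A => 1 + t ^ 2 :=
  ⟨fun i => if i = 1 then 1 else 0, rfl, fun i hi => if_neg hi.ne', fun t => by
    simp⟩

theorem IsMonicForm.step {j : ℕ} {f g : A → A} (hf : IsMonicForm (j + 1) f)
    (hg : IsMonicForm j g) (a : A) :
    IsMonicForm (j + 2) fun t => (1 + t ^ 2) * f t - a * (t ^ 2 * g t) := by
  obtain ⟨c, hc1, hc0, hc⟩ := hf
  obtain ⟨d, hd1, hd0, hd⟩ := hg
  refine ⟨fun i => (if i = 0 then 0 else c (i - 1)) - a * d i, ?_, ?_, fun t => ?_⟩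
  · simp [hc1, hd0 (j + 2) (by omega)]
  · intro i hi
    simp only
    rw [if_neg (by omega), hc0 (i - 1) (by omega), hd0 i (by omega), mul_zero, sub_zero]
  · simp only [sub_mul, Finset.sum_sub_distrib]
    congr 1
    · rw [Finset.sum_range_succ', hc, Finset.mul_sum]
      simp only [if_true, zero_mul, add_zero]
      refine Finset.sum_congr rfl fun i _ => ?_
      rw [if_neg (Nat.succ_ne_zero i), Nat.add_sub_cancel, show j + 2 - (i + 1) = j + 1 - i by omega]
      ring
    · rw [Finset.sum_range_succ, Finset.sum_range_succ, hd0 (j + 2) (by omega),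
        hd0 (j + 1) (by omega), mul_zero, zero_mul, add_zero, zero_mul, add_zero, hd,
        Finset.mul_sum, Finset.mul_sum]
      refine Finset.sum_congr rfl fun i hi => ?_
      rw [show j + 2 - i = (j - i) + 2 by have := Finset.mem_range.1 hi; omega]
      ring

theorem vdm_eq_prod (t : Fin n → A) : vdm t = ∏ i, ∏ j ∈ Finset.Ioi i, (t i - t j) := by
  have h := Matrix.det_projVandermonde (1 : Fin n → A) t
  simp only [Pi.one_apply, one_mul] at h
  rw [← h, vdm]
  congr 1
  ext i j
  simp [Matrix.projVandermonde_apply]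

/-- Determinants of monic forms in `1 + t ^ 2` and `t` reduce by column operations to a homogeneous
Vandermonde determinant, with factors
`(1 + t_j ^ 2) t_i - (1 + t_i ^ 2) t_j = (t_i - t_j) (1 - t_i t_j)`. -/
theorem det_isMonicForm (t : Fin n → A) (f : ℕ → A → A) (hf : ∀ j, IsMonicForm j (f j)) :
    Matrix.det (Matrix.of fun k j : Fin n => t k ^ (j.rev : ℕ) * f j (t k)) =
      vdm t * pairProd t := by
  choose c hc1 hc0 hc using hf
  have hM : (Matrix.of fun k j : Fin n => t k ^ (j.rev : ℕ) * f j (t k)) =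
      Matrix.projVandermonde (fun k => 1 + t k ^ 2) t *
        Matrix.of fun i j : Fin n => c j i := by
    ext k j
    rw [Matrix.mul_apply, Matrix.of_apply, hc]
    simp only [Matrix.projVandermonde_apply, Matrix.of_apply]
    have hj := j.2
    rw [Finset.sum_subset (Finset.range_mono (show (j : ℕ) + 1 ≤ n from j.2))
      (fun i _ hi => by rw [hc0 _ i (by simpa using hi), zero_mul]),
      ← Fin.sum_univ_eq_sum_range (fun i => c j i * ((1 + t k ^ 2) ^ i * t k ^ ((j : ℕ) - i))),
      Finset.mul_sum]
    refine Finset.sum_congr rfl fun i _ => ?_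
    rcases le_or_gt (i : ℕ) j with hij | hij
    · rw [show (i.rev : ℕ) = (j.rev : ℕ) + ((j : ℕ) - i) by
        rw [Fin.val_rev, Fin.val_rev]; omega, pow_add]
      ring
    · rw [hc0 _ _ hij]
      ring
  have htri : (Matrix.of fun i j : Fin n => c j i).BlockTriangular id := fun i j hij =>
    hc0 _ _ hij
  rw [hM, Matrix.det_mul, Matrix.det_of_isUpperTriangular htri]
  simp only [Matrix.of_apply, hc1, Finset.prod_const_one, mul_one]
  rw [Matrix.det_projVandermonde, vdm_eq_prod, pairProd, ← Finset.prod_mul_distrib]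
  refine Finset.prod_congr rfl fun i _ => ?_
  rw [← Finset.prod_filter, Finset.filter_lt_eq_Ioi, ← Finset.prod_mul_distrib]
  refine Finset.prod_congr rfl fun j _ => ?_
  ring

/-- The Weyl denominator formula of type `C`. -/
theorem det_pow_sub_pow (t : Fin n → A) :
    Matrix.det (Matrix.of fun k j : Fin n => t k ^ (j.rev : ℕ) - t k ^ (n + 1 + (j : ℕ))) =
      vdm t * pairProd t * ∏ k, (1 - t k ^ 2) := by
  have hform : ∀ j, IsMonicForm j fun t : A => ∑ i ∈ Finset.range (j + 1), (t ^ 2) ^ i := by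
    intro j
    induction j using Nat.twoStepInduction with
    | zero => simpa using isMonicForm_zero
    | one => simpa [Finset.sum_range_succ] using isMonicForm_one (A := A)
    | more j h0 h1 =>
      convert h1.step h0 1 using 2 with t
      simp only [Finset.sum_range_succ _ (j + 1), Finset.sum_range_succ _ (j + 2)]
      ring
  rw [← det_isMonicForm t _ hform, mul_comm, ← Matrix.det_mul_column]
  congr 1
  ext k j
  have h := mul_neg_geom_sum (t k ^ 2) ((j : ℕ) + 1)
  simp only [Matrix.of_apply]
  rw [mul_left_comm, h, mul_sub, mul_one, ← pow_mul, ← pow_add]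
  congr 2
  have := j.2
  rw [Fin.val_rev]
  omega

/-- The Weyl denominator formula of type `D`; the factor `2` comes from the first column. -/
theorem det_pow_add_pow (t : Fin (n + 1) → A) :
    Matrix.det (Matrix.of fun k j : Fin (n + 1) => t k ^ (j.rev : ℕ) + t k ^ (n + (j : ℕ))) =
      2 * (vdm t * pairProd t) := by
  have hform : ∀ j, IsMonicForm j fun t : A => if j = 0 then 1 else 1 + (t ^ 2) ^ j := by
    intro j
    induction j using Nat.twoStepInduction with
    | zero => simpa using isMonicForm_zero
    | one => simpa using isMonicForm_one (A := A)
    | more j h0 h1 =>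
      rcases j with _ | j
      · convert h1.step h0 2 using 2 with t
        simp only [one_ne_zero, if_false, if_true, OfNat.ofNat_ne_zero, zero_add]
        ring
      · convert h1.step h0 1 using 2 with t
        simp only [Nat.add_eq_zero_iff, one_ne_zero, and_false, if_false, OfNat.ofNat_ne_zero]
        ring
  have h2 : ∏ j : Fin (n + 1), (if j = 0 then (2 : A) else 1) = 2 := by simp
  rw [← det_isMonicForm t _ hform, ← h2, ← Matrix.det_mul_row]
  congr 1
  ext k j
  simp only [Matrix.of_apply, Fin.ext_iff, Fin.val_zero]
  have hj := j.2
  split_ifs with h0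
  · rw [h0, mul_one, add_zero, Fin.val_rev, h0, two_mul]
    rfl
  · rw [one_mul, mul_add, mul_one, ← pow_mul, ← pow_add]
    congr 2
    rw [Fin.val_rev]
    omega

end WeylDenominator

section GeneratingSeries

variable {R : Type*} [CommRing R] {n : ℕ}

/-- Pulling the series `H(t_k)` out of a determinant. -/
theorem det_inVar_mul (G : Fin n → PowerSeries R) (H : PowerSeries R) :
    Matrix.det (Matrix.of fun k j : Fin n => inVar k (G j * H)) =
      (∏ k, inVar k H) * Matrix.det (Matrix.of fun k j : Fin n => inVar k (G j)) := by
  rw [← Matrix.det_mul_column]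
  congr 1
  ext k j : 1
  simp only [Matrix.of_apply, map_mul, mul_comm]

theorem vdmX_mul_prod_inVar (H : PowerSeries R) : vdmX R n * ∏ k, inVar k H =
    Matrix.det (Matrix.of fun k j : Fin n => inVar k (PowerSeries.X ^ (j.rev : ℕ) * H)) := by
  rw [det_inVar_mul, mul_comm, vdmX, vdm]
  simp only [map_pow, inVar_X]

theorem orthSeries_eq (H : PowerSeries R) :
    vdmX R n * pairProd MvPowerSeries.X * ∏ k, inVar k ((1 - PowerSeries.X ^ 2) * H) =
    Matrix.det (Matrix.of fun k j : Fin n => inVar k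
      ((PowerSeries.X ^ (j.rev : ℕ) - PowerSeries.X ^ (n + 1 + (j : ℕ))) * H)) := by
  rw [det_inVar_mul]
  simp only [map_pow, inVar_X, map_sub, map_mul, map_one, Finset.prod_mul_distrib,
    det_pow_sub_pow]
  ring

theorem sympSeries_eq (H : PowerSeries R) :
    2 * (vdmX R (n + 1) * pairProd MvPowerSeries.X * ∏ k, inVar k H) =
    Matrix.det (Matrix.of fun k j : Fin (n + 1) => inVar k
      ((PowerSeries.X ^ (j.rev : ℕ) + PowerSeries.X ^ (n + (j : ℕ))) * H)) := by
  rw [det_inVar_mul]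
  simp only [map_pow, inVar_X, map_add, det_pow_add_pow]
  ring

/-- The coefficients of `V(T) ∏ H(t_k)` are Jacobi-Trudi determinants. -/
theorem coeffAt_vdmX_mul_prod_inVar {H : PowerSeries R} (hH : PowerSeries.constantCoeff H = 1)
    {lam : YoungDiagram} (hl : lam.colLen 0 ≤ n) :
    coeffAt (shifted n lam) (vdmX R n * ∏ k, inVar k H) = jacobiTrudi (seqOf H) lam := by
  rw [vdmX_mul_prod_inVar, coeffAt_det_inVar, jacobiTrudi_eq_det _
    (fun m hm => seqOf_of_neg _ hm) (by rw [seqOf_zero, hH]) hl]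
  congr 1
  ext k j
  have hj := j.2
  have hk := k.2
  simp only [Matrix.of_apply, coeff_X_pow_mul_eq_seqOf]
  congr 1
  simp only [shifted, Fin.val_rev]
  omega

theorem coeffAt_orthSeries {H : PowerSeries R} (hH : PowerSeries.constantCoeff H = 1)
    {lam : YoungDiagram} (hl : lam.colLen 0 ≤ n) :
    coeffAt (shifted n lam)
      (vdmX R n * pairProd MvPowerSeries.X * ∏ k, inVar k ((1 - PowerSeries.X ^ 2) * H)) =
      jacobiTrudiOrth (seqOf H) lam := by
  rw [orthSeries_eq, coeffAt_det_inVar, jacobiTrudiOrth_eq_det _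
    (fun m hm => seqOf_of_neg _ hm) (by rw [seqOf_zero, hH]) hl]
  congr 1
  ext k j
  have hj := j.2
  have hk := k.2
  simp only [Matrix.of_apply, sub_mul, map_sub, coeff_X_pow_mul_eq_seqOf]
  congr 2 <;>
  · simp only [shifted, Fin.val_rev]
    omega

theorem coeffAt_sympSeries [Invertible (2 : R)] {H : PowerSeries R}
    (hH : PowerSeries.constantCoeff H = 1) {lam : YoungDiagram} (hl : lam.colLen 0 ≤ n)
    (hn : 0 < n) :
    coeffAt (shifted n lam) (vdmX R n * pairProd MvPowerSeries.X * ∏ k, inVar k H) =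
      jacobiTrudiSymp (seqOf H) lam := by
  obtain ⟨n, rfl⟩ := Nat.exists_eq_succ_of_ne_zero hn.ne'
  have h := congrArg (coeffAt (shifted (n + 1) lam)) (sympSeries_eq (n := n) H)
  rw [coeffAt_det_inVar, two_mul, map_add, ← two_mul] at h
  rw [jacobiTrudiSymp_eq_det _ (fun m hm => seqOf_of_neg _ hm) (by rw [seqOf_zero, hH]) hl hn]
  refine (isUnit_of_invertible (2 : R)).mul_left_cancel ?_
  rw [mul_invOf_cancel_left]
  refine h.trans ?_
  congr 1
  ext k j
  have hj := j.2
  have hk := k.2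
  simp only [Matrix.of_apply, add_mul, map_add, coeff_X_pow_mul_eq_seqOf]
  congr 2 <;>
  · simp only [shifted, Fin.val_rev]
    omega

theorem isAlternating_orthSeries (H : PowerSeries R) : IsAlternating
    (vdmX R n * pairProd MvPowerSeries.X * ∏ k, inVar k ((1 - PowerSeries.X ^ 2) * H)) := by
  rw [orthSeries_eq]
  exact isAlternating_det_inVar _

theorem isAlternating_sympSeries [Invertible (2 : R)] (H : PowerSeries R) (hn : 0 < n) :
    IsAlternating (vdmX R n * pairProd MvPowerSeries.X * ∏ k, inVar k H) := by
  obtain ⟨n, rfl⟩ := Nat.exists_eq_succ_of_ne_zero hn.ne'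
  have h := (isAlternating_det_inVar (R := R) fun j : Fin (n + 1) =>
    (PowerSeries.X ^ (j.rev : ℕ) + PowerSeries.X ^ (n + (j : ℕ))) * H).smul (⅟(2 : R))
  rw [← sympSeries_eq, ← map_ofNat (MvPowerSeries.C (σ := Fin (n + 1)) (R := R)) 2,
    ← MvPowerSeries.smul_eq_C_mul, smul_smul, invOf_mul_self, one_smul] at h
  exact h

end GeneratingSeries

/-! ### Comparison of coefficients -/

section Pairing

variable {R : Type*} [CommRing R] {n : ℕ}

/-- The coefficients of a product of degree at most `D` only depend on the coefficients of the first
factor of degree at most `D`. -/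
theorem coeffAt_mul_congr {f f' : MvPowerSeries (Fin n) R} {D : ℕ}
    (h : ∀ m : Fin n → ℕ, ∑ k, m k ≤ D → coeffAt m f = coeffAt m f')
    (g : MvPowerSeries (Fin n) R) {m : Fin n → ℕ} (hm : ∑ k, m k ≤ D) :
    coeffAt m (f * g) = coeffAt m (f' * g) := by
  classical
  rw [coeffAt, MvPowerSeries.coeff_mul, MvPowerSeries.coeff_mul]
  refine Finset.sum_congr rfl fun x hx => ?_
  rw [coeff_eq_coeffAt x.1 f, coeff_eq_coeffAt x.1 f', h]
  rw [Finset.HasAntidiagonal.mem_antidiagonal] at hx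
  refine le_trans (Finset.sum_le_sum fun k _ => ?_) hm
  have := DFunLike.congr_fun hx k
  rw [Finsupp.add_apply, Finsupp.equivFunOnFinite_symm_apply_apply] at this
  omega

/-- If `V F = ∑ χ(κ) a_{κ+δ}` and `V G = ∑ e(μ) a_{μ+δ}`, then the coefficient of `a_{λ+δ}` in
`V F G` is obtained from Littlewood-Richardson coefficients. -/
theorem coeffAt_mul_eq_sum_littlewoodRichardson {f g : MvPowerSeries (Fin n) R}
    {χ e : YoungDiagram → R} (hf : IsAlternating f)
    (hχ : ∀ ka : YoungDiagram, ka.colLen 0 ≤ n → coeffAt (shifted n ka) f = χ ka)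
    (hg : IsAlternating (vdmX R n * g))
    (he : ∀ mu : YoungDiagram, mu.colLen 0 ≤ n → coeffAt (shifted n mu) (vdmX R n * g) = e mu)
    {lam : YoungDiagram} (hn : lam.card + lam.card ≤ n) :
    coeffAt (shifted n lam) (f * g) = ∑ mu ∈ partsLE lam.card, ∑ ka ∈ partsLE lam.card,
      χ ka * (littlewoodRichardson lam ka mu : R) * e mu := by
  have hN : lam.card ≤ n := by omega
  have hlam : lam.colLen 0 ≤ n := (colLen_zero_le_card lam).trans hN
  have hlen : ∀ mu ∈ partsLE lam.card, mu.colLen 0 ≤ n := fun mu h =>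
    colLen_le_of_mem_partsLE hN h
  have expand : ∀ {f : MvPowerSeries (Fin n) R} {χ : YoungDiagram → R}, IsAlternating f →
      (∀ ka : YoungDiagram, ka.colLen 0 ≤ n → coeffAt (shifted n ka) f = χ ka) →
      ∀ g, coeffAt (shifted n lam) (f * g) = coeffAt (shifted n lam)
        ((∑ ka ∈ partsLE lam.card, MvPowerSeries.C (χ ka) * alternant R n ka) * g) := by
    intro f χ hf hχ g
    refine coeffAt_mul_congr (fun m hm => ?_) g (sum_shifted hlam).le
    rw [hf.coeffAt_eq_sum_alternant hN m hm]
    refine congrArg _ (Finset.sum_congr rfl fun ka hka => ?_)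
    rw [hχ ka (hlen ka hka)]
  have h1 : (∑ ka ∈ partsLE lam.card, MvPowerSeries.C (χ ka) * alternant R n ka) * g =
      (vdmX R n * g) * ∑ ka ∈ partsLE lam.card, MvPowerSeries.C (χ ka) * schurSeries R n ka := by
    rw [Finset.sum_mul, Finset.mul_sum]
    refine Finset.sum_congr rfl fun ka hka => ?_
    rw [alternant_eq_vdm_mul (hlen ka hka)]
    ring
  rw [expand hf hχ, h1, expand hg he, Finset.sum_mul, map_sum]
  refine Finset.sum_congr rfl fun mu hmu => ?_
  rw [Finset.mul_sum, map_sum]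
  refine Finset.sum_congr rfl fun ka hka => ?_
  have hcard : ka.card + mu.card ≤ n := by
    have h1 := mem_partsLE.1 hka
    have h2 := mem_partsLE.1 hmu
    omega
  have h2 : MvPowerSeries.C (e mu) * alternant R n mu *
      (MvPowerSeries.C (χ ka) * schurSeries R n ka) =
      (χ ka * e mu) • (schurSeries R n ka * schurSeries R n mu * vdmX R n) := by
    rw [alternant_eq_vdm_mul (hlen mu hmu), MvPowerSeries.smul_eq_C_mul, map_mul]
    ring
  rw [h2, map_smul, littlewoodRichardson_eq_structureCoeff hcard hlam, structureCoeff, smul_eq_mul]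
  ring

theorem finite_littlewoodRichardson_ne_zero (lam : YoungDiagram) :
    {p : YoungDiagram × YoungDiagram | littlewoodRichardson lam p.1 p.2 ≠ 0}.Finite := by
  refine (partsLE lam.card ×ˢ partsLE lam.card).finite_toSet.subset fun p hp => ?_
  have := card_eq_of_littlewoodRichardson_ne_zero hp
  rw [Finset.mem_coe, Finset.mem_product, mem_partsLE, mem_partsLE]
  omega

theorem sum_littlewoodRichardson_eq_finsum (lam : YoungDiagram) (χ e : YoungDiagram → R) :
    ∑ mu ∈ partsLE lam.card, ∑ ka ∈ partsLE lam.card,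
      χ ka * (littlewoodRichardson lam ka mu : R) * e mu =
    ∑ᶠ mu : YoungDiagram, ∑ᶠ ka : YoungDiagram,
      χ ka * (littlewoodRichardson lam ka mu : R) * e mu := by
  have hzero : ∀ ka mu, ka ∉ partsLE lam.card ∨ mu ∉ partsLE lam.card →
      χ ka * (littlewoodRichardson lam ka mu : R) * e mu = 0 := by
    intro ka mu h
    rw [mem_partsLE, mem_partsLE] at h
    have h0 : littlewoodRichardson lam ka mu = 0 := by
      by_contra hne
      have := card_eq_of_littlewoodRichardson_ne_zero hne
      omega
    rw [h0, Int.cast_zero, mul_zero, zero_mul]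
  have hin : ∀ mu, ∑ᶠ ka : YoungDiagram, χ ka * (littlewoodRichardson lam ka mu : R) * e mu =
      ∑ ka ∈ partsLE lam.card, χ ka * (littlewoodRichardson lam ka mu : R) * e mu := by
    intro mu
    refine finsum_eq_sum_of_support_subset _ fun ka hka => ?_
    by_contra h
    exact hka (hzero ka mu (Or.inl h))
  simp only [hin]
  refine (finsum_eq_sum_of_support_subset _ fun mu hmu => ?_).symm
  by_contra h
  exact hmu (Finset.sum_eq_zero fun ka _ => hzero ka mu (Or.inr h))

open scoped Classical in
theorem finsum_indicator_littlewoodRichardson (lam : YoungDiagram) (S : Set YoungDiagram)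
    (e : YoungDiagram → R) :
    ∑ᶠ mu : YoungDiagram, ∑ᶠ ka : YoungDiagram,
      (if ka ∈ S then 1 else 0) * (littlewoodRichardson lam ka mu : R) * e mu =
    ∑ᶠ mu : YoungDiagram, ∑ᶠ ka ∈ S, (littlewoodRichardson lam ka mu : R) * e mu := by
  refine finsum_congr fun mu => ?_
  rw [finsum_mem_def]
  refine finsum_congr fun ka => ?_
  rw [Set.indicator_apply, mul_assoc, ite_mul, one_mul, zero_mul]

/-- The weights `χ` are the coefficients of the Schur functions in
`∏_{i<j} (1 - t_i t_j)⁻¹ ∏_k φ(t_k)⁻¹`, in any number of variables. -/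
def IsLittlewoodWeight (φ : PowerSeries R) (χ : YoungDiagram → R) : Prop :=
  ∀ (n : ℕ) (f : MvPowerSeries (Fin n) R), f * littlewoodDenom n φ = vdmX R n →
    ∀ ka : YoungDiagram, ka.colLen 0 ≤ n → coeffAt (shifted n ka) f = χ ka

variable [Invertible (2 : R)] {φ H K : PowerSeries R} {χ : YoungDiagram → R}

theorem jacobiTrudi_eq_finsum_orth (hφ : PowerSeries.constantCoeff φ = 1)
    (hχ : IsLittlewoodWeight φ χ) (hH : PowerSeries.constantCoeff H = 1)
    (hK : PowerSeries.constantCoeff K = 1) (h : H * φ = (1 - PowerSeries.X ^ 2) * K)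
    (lam : YoungDiagram) :
    jacobiTrudi (seqOf H) lam = ∑ᶠ mu : YoungDiagram, ∑ᶠ ka : YoungDiagram,
      χ ka * (littlewoodRichardson lam ka mu : R) * jacobiTrudiOrth (seqOf K) mu := by
  set n := lam.card + lam.card with hn
  have hl : lam.colLen 0 ≤ n := (colLen_zero_le_card lam).trans (by omega)
  obtain ⟨f, hf⟩ := exists_mul_littlewoodDenom (n := n) hφ
  have halt := isAlternating_of_mul_littlewoodDenom
    (fun a ha => (isUnit_of_invertible (2 : R)).mul_right_eq_zero.1 ha) hφ hf
  have hprod : vdmX R n * ∏ k, inVar k H = f * (pairProd MvPowerSeries.X *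
      ∏ k, inVar k ((1 - PowerSeries.X ^ 2) * K)) := by
    rw [← hf, littlewoodDenom, ← h]
    simp only [map_mul, Finset.prod_mul_distrib]
    ring
  rw [← coeffAt_vdmX_mul_prod_inVar hH hl, hprod, ← sum_littlewoodRichardson_eq_finsum]
  refine coeffAt_mul_eq_sum_littlewoodRichardson halt (hχ n f hf) ?_ (fun mu hmu => ?_) hn.ge
  · rw [← mul_assoc]
    exact isAlternating_orthSeries K
  · rw [← mul_assoc]
    exact coeffAt_orthSeries hK hmu

theorem jacobiTrudi_eq_finsum_symp (hφ : PowerSeries.constantCoeff φ = 1)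
    (hχ : IsLittlewoodWeight φ χ) (hH : PowerSeries.constantCoeff H = 1)
    (hK : PowerSeries.constantCoeff K = 1) (h : H * φ = K) (lam : YoungDiagram) :
    jacobiTrudi (seqOf H) lam = ∑ᶠ mu : YoungDiagram, ∑ᶠ ka : YoungDiagram,
      χ ka * (littlewoodRichardson lam ka mu : R) * jacobiTrudiSymp (seqOf K) mu := by
  -- an additional variable, so that there is at least one
  set n := lam.card + lam.card + 1 with hn
  have hl : lam.colLen 0 ≤ n := (colLen_zero_le_card lam).trans (by omega)
  obtain ⟨f, hf⟩ := exists_mul_littlewoodDenom (n := n) hφ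
  have halt := isAlternating_of_mul_littlewoodDenom
    (fun a ha => (isUnit_of_invertible (2 : R)).mul_right_eq_zero.1 ha) hφ hf
  have hprod : vdmX R n * ∏ k, inVar k H = f * (pairProd MvPowerSeries.X * ∏ k, inVar k K) := by
    rw [← hf, littlewoodDenom, ← h]
    simp only [map_mul, Finset.prod_mul_distrib]
    ring
  rw [← coeffAt_vdmX_mul_prod_inVar hH hl, hprod, ← sum_littlewoodRichardson_eq_finsum]
  refine coeffAt_mul_eq_sum_littlewoodRichardson halt (hχ n f hf) ?_ (fun mu hmu => ?_) (by omega)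
  · rw [← mul_assoc]
    exact isAlternating_sympSeries K (by omega)
  · rw [← mul_assoc]
    exact coeffAt_sympSeries hK hmu (by omega)

end Pairing

/-! ### Generating functions of alphabets -/

section Alphabets

variable {R : Type*} [CommRing R] [TopologicalSpace R] {ι κ : Type*} {x : ι → R} {y : κ → R}

theorem constantCoeff_oneSub {A : Type*} [CommRing A] (a : A) :
    PowerSeries.constantCoeff (oneSub a) = 1 := by
  simp [oneSub]

theorem constantCoeff_tprod_oneSub [T2Space R] (hx : IsAlphabet x) :
    PowerSeries.constantCoeff (∏' i, oneSub (x i)) = 1 := by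
  rw [Multipliable.map_tprod hx (PowerSeries.constantCoeff (R := R))
    (PowerSeries.WithPiTopology.continuous_constantCoeff (R := R))]
  simp only [constantCoeff_oneSub, tprod_one]

theorem isAlphabet_adjoin [IsTopologicalRing R] (hx : IsAlphabet x) (a : R) : IsAlphabet (adjoin x a) :=
  Multipliable.sum _ hx (hasProd_fintype _).multipliable

theorem tprod_oneSub_adjoin [IsTopologicalRing R] [T2Space R] (hx : IsAlphabet x) (a : R) :
    ∏' i, oneSub (adjoin x a i) = (∏' i, oneSub (x i)) * oneSub a := by
  have h : ∏' i : Unit, oneSub (adjoin x a (Sum.inr i)) = oneSub a := by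
    rw [tprod_fintype, Fintype.prod_unique]
    rfl
  rw [← h]
  exact Multipliable.tprod_sum (f := fun i => oneSub (adjoin x a i)) hx
    (hasProd_fintype _).multipliable

theorem genFun_mul_tprod [T2Space R] (hx : IsAlphabet x) :
    genFun x y * (∏' i, oneSub (x i)) = ∏' j, oneSub (y j) := by
  have h := PowerSeries.mul_invOfUnit (∏' i, oneSub (x i)) 1 (constantCoeff_tprod_oneSub hx)
  rw [genFun, mul_assoc, mul_comm (PowerSeries.invOfUnit _ _), h, mul_one]

theorem isUnit_tprod_oneSub [T2Space R] (hx : IsAlphabet x) : IsUnit (∏' i, oneSub (x i)) := by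
  rw [PowerSeries.isUnit_iff_constantCoeff, constantCoeff_tprod_oneSub hx]
  exact isUnit_one

theorem constantCoeff_genFun [T2Space R] (hx : IsAlphabet x) (hy : IsAlphabet y) :
    PowerSeries.constantCoeff (genFun x y) = 1 := by
  have h := congrArg (PowerSeries.constantCoeff (R := R)) (genFun_mul_tprod (y := y) hx)
  rwa [map_mul, constantCoeff_tprod_oneSub hx, constantCoeff_tprod_oneSub hy, mul_one] at h

theorem genFun_adjoin_right [IsTopologicalRing R] [T2Space R] (hx : IsAlphabet x)
    (hy : IsAlphabet y) (a : R) :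
    genFun x (adjoin y a) = genFun x y * oneSub a := by
  refine (isUnit_tprod_oneSub hx).mul_right_cancel ?_
  rw [genFun_mul_tprod hx, tprod_oneSub_adjoin hy, ← genFun_mul_tprod (y := y) hx]
  ring

theorem genFun_adjoin_left_mul [IsTopologicalRing R] [T2Space R] (hx : IsAlphabet x) (a : R) :
    genFun (adjoin x a) y * oneSub a = genFun x y := by
  refine (isUnit_tprod_oneSub hx).mul_right_cancel ?_
  rw [genFun_mul_tprod hx, mul_assoc, mul_comm (oneSub a), ← tprod_oneSub_adjoin hx,
    genFun_mul_tprod (isAlphabet_adjoin hx a)]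

end Alphabets

section Weights

variable {R : Type*} [CommRing R]

theorem oneSub_mul_oneSub_neg {ξ : R} (hξ : ξ ^ 2 = 1) :
    oneSub ξ * oneSub (-ξ) = 1 - PowerSeries.X ^ 2 := by
  have h : (PowerSeries.C ξ : PowerSeries R) ^ 2 = 1 := by rw [← map_pow, hξ, map_one]
  rw [oneSub, oneSub, map_neg]
  linear_combination (-PowerSeries.X ^ 2) * h

open scoped Classical in
theorem isLittlewoodWeight_evenRows :
    IsLittlewoodWeight (1 - PowerSeries.X ^ 2 : PowerSeries R)
      (fun ka => if ka ∈ evenRows then 1 else 0) :=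
  fun _ _ hf _ hka => coeffAt_littlewood_evenRows hf hka

open scoped Classical in
theorem isLittlewoodWeight_evenCols [Invertible (2 : R)] :
    IsLittlewoodWeight (1 : PowerSeries R) (fun ka => if ka ∈ evenCols then 1 else 0) :=
  fun _ _ hf _ hka => coeffAt_littlewood_evenCols (isUnit_of_invertible 2) hf hka

theorem isLittlewoodWeight_pow_card {ξ : R} (hξ : ξ ^ 2 = 1) :
    IsLittlewoodWeight (oneSub ξ) (fun ka => ξ ^ ka.card) :=
  fun _ _ hf _ hka => coeffAt_littlewood_all hξ hf hka

end Weights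

end SuperSchur

theorem mainTheorem2 {R : Type*} [CommRing R] [TopologicalSpace R] [IsTopologicalRing R]
    [T2Space R] [Invertible (2 : R)] {ι κ : Type*} (x : ι → R) (y : κ → R)
    (hx : IsAlphabet x) (hy : IsAlphabet y) (ξ : R) (hξ : ξ = 1 ∨ ξ = -1)
    (lam : YoungDiagram) :
    {p : YoungDiagram × YoungDiagram | littlewoodRichardson lam p.1 p.2 ≠ 0}.Finite ∧
    schur lam x y =
      ∑ᶠ μ : YoungDiagram, ∑ᶠ ρ ∈ evenRows,
        (littlewoodRichardson lam ρ μ : R) * orthSchur μ x y ∧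
    schur lam x y =
      ∑ᶠ μ : YoungDiagram, ∑ᶠ ρ ∈ evenCols,
        (littlewoodRichardson lam ρ μ : R) * sympSchur μ x y ∧
    schur lam x (adjoin y ξ) =
      ∑ᶠ μ : YoungDiagram, ∑ᶠ ρ ∈ evenCols,
        (littlewoodRichardson lam ρ μ : R) * orthSchur μ (adjoin x (-ξ)) y ∧
    schur lam x (adjoin y ξ) =
      ∑ᶠ μ : YoungDiagram, ∑ᶠ ν : YoungDiagram,
        (-ξ) ^ ν.card * (littlewoodRichardson lam ν μ : R) * orthSchur μ x y ∧
    schur lam (adjoin x ξ) y =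
      ∑ᶠ μ : YoungDiagram, ∑ᶠ ρ ∈ evenRows,
        (littlewoodRichardson lam ρ μ : R) * sympSchur μ x (adjoin y (-ξ)) ∧
    schur lam (adjoin x ξ) y =
      ∑ᶠ μ : YoungDiagram, ∑ᶠ ν : YoungDiagram,
        ξ ^ ν.card * (littlewoodRichardson lam ν μ : R) * sympSchur μ x y ∧
    schur lam x (adjoin (adjoin y 1) (-1)) =
      ∑ᶠ μ : YoungDiagram, ∑ᶠ ρ ∈ evenCols,
        (littlewoodRichardson lam ρ μ : R) * orthSchur μ x y ∧
    schur lam (adjoin (adjoin x 1) (-1)) y =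
      ∑ᶠ μ : YoungDiagram, ∑ᶠ ρ ∈ evenRows,
        (littlewoodRichardson lam ρ μ : R) * sympSchur μ x y := by
  have hξ2 : ξ ^ 2 = 1 := by rcases hξ with rfl | rfl <;> ring
  have hξ2' : (-ξ) ^ 2 = 1 := by rw [neg_sq, hξ2]
  have hφ : PowerSeries.constantCoeff (1 - PowerSeries.X ^ 2 : PowerSeries R) = 1 := by simp
  have hφ1 : PowerSeries.constantCoeff (1 : PowerSeries R) = 1 := by simp
  have hprod := oneSub_mul_oneSub_neg hξ2
  have hprod1 := oneSub_mul_oneSub_neg (one_pow 2 : (1 : R) ^ 2 = 1)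
  have hH := constantCoeff_genFun hx hy
  have hxξ := isAlphabet_adjoin hx ξ
  have hyξ := isAlphabet_adjoin hy ξ
  refine ⟨finite_littlewoodRichardson_ne_zero lam, ?_, ?_, ?_, ?_, ?_, ?_, ?_, ?_⟩
  · refine Eq.trans ?_ (finsum_indicator_littlewoodRichardson lam _ _)
    exact jacobiTrudi_eq_finsum_orth hφ isLittlewoodWeight_evenRows hH hH (mul_comm _ _) lam
  · refine Eq.trans ?_ (finsum_indicator_littlewoodRichardson lam _ _)
    exact jacobiTrudi_eq_finsum_symp hφ1 isLittlewoodWeight_evenCols hH hH (mul_one _) lam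
  · refine Eq.trans ?_ (finsum_indicator_littlewoodRichardson lam _ _)
    refine jacobiTrudi_eq_finsum_orth hφ1 isLittlewoodWeight_evenCols
      (constantCoeff_genFun hx hyξ) (constantCoeff_genFun (isAlphabet_adjoin hx (-ξ)) hy) ?_ lam
    rw [genFun_adjoin_right hx hy, ← genFun_adjoin_left_mul hx (-ξ), ← hprod]
    ring
  · refine jacobiTrudi_eq_finsum_orth (constantCoeff_oneSub (-ξ))
      (isLittlewoodWeight_pow_card hξ2') (constantCoeff_genFun hx hyξ) hH ?_ lam
    rw [genFun_adjoin_right hx hy, ← hprod]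
    ring
  · refine Eq.trans ?_ (finsum_indicator_littlewoodRichardson lam _ _)
    refine jacobiTrudi_eq_finsum_symp hφ isLittlewoodWeight_evenRows
      (constantCoeff_genFun hxξ hy) (constantCoeff_genFun hx (isAlphabet_adjoin hy (-ξ))) ?_ lam
    rw [genFun_adjoin_right hx hy, ← genFun_adjoin_left_mul hx ξ, ← hprod]
    ring
  · exact jacobiTrudi_eq_finsum_symp (constantCoeff_oneSub ξ)
      (isLittlewoodWeight_pow_card hξ2) (constantCoeff_genFun hxξ hy) hH
      (genFun_adjoin_left_mul hx ξ) lam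
  · have hy1 := isAlphabet_adjoin hy 1
    refine Eq.trans ?_ (finsum_indicator_littlewoodRichardson lam _ _)
    refine jacobiTrudi_eq_finsum_orth hφ1 isLittlewoodWeight_evenCols
      (constantCoeff_genFun hx (isAlphabet_adjoin hy1 (-1))) hH ?_ lam
    rw [genFun_adjoin_right hx hy1, genFun_adjoin_right hx hy, ← hprod1]
    ring
  · have hx1 := isAlphabet_adjoin hx 1
    refine Eq.trans ?_ (finsum_indicator_littlewoodRichardson lam _ _)
    refine jacobiTrudi_eq_finsum_symp hφ isLittlewoodWeight_evenRows
      (constantCoeff_genFun (isAlphabet_adjoin hx1 (-1)) hy) hH ?_ lam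
    rw [← genFun_adjoin_left_mul hx 1, ← genFun_adjoin_left_mul hx1 (-1), ← hprod1]
    ring
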